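/- Let $K$ be a field of characteristic $0$. The Buttin superalgebra $B(1)$ is the space $K[[x]]\oplus K[[x]]X$ of formal power series in one even variable $x$ and one odd variable $X$, with the bracket $$\{f,g\}=\frac{\partial f}{\partial x}\frac{\partial g}{\partial X}+(-1)^{p(f)}\frac{\partial f}{\partial X}\frac{\partial g}{\partial x},$$ where $p(f)$ is the parity of the generating function $f$; as elements of the Lie superalgebra the series $f_1(x)X$ are even and the series $f_0(x)$ are odd. Its center is $Z=K\cdot 1$, and the Leites superalgebra is $Le(1)=B(1)/Z$, with topological basis $E_i=x^iX$ $(i\ge 0$, even$)$ and $O_i=x^i$ $(i\ge 1$, odd$)$. The grading is given by $g(x)=1$, $g(X)=-1$. Let $C^k$ be the space of $k$-cochains with values in the trivial module $K$: the $k$-linear maps $C: Le(1)^k\to K$ that are continuous (there is an $N$ such that $C$ vanishes as soon as one argument is the class of a series divisible by $x^N$) and super skew-symmetric (transposing two adjacent homogeneous arguments of parities $p,q$ multiplies the value by $-(-1)^{pq}$). The differential $d:C^k\to C^{k+1}$ is given, for homogeneous $u_0,\dots,u_k$ of parities $p_0,\dots,p_k$, by $$dC(u_0,\dots,u_k)=\sum_{i<j}(-1)^{j+p_j(p_{i+1}+\cdots+p_{j-1})}\,C(u_0,\dots,u_{i-1},[u_i,u_j],u_{i+1},\dots,\widehat{u_j},\dots,u_k),$$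 and $H^k(Le(1))=Z^k/B^k$, where $Z^k=\{C\in C^k: dC=0\}$, $B^k=dC^{k-1}$ and $B^0=0$. For distinct basis elements $e_1,\dots,e_k$, at most one of them odd, $C(e_1,\dots,e_k)$ denotes the exterior product of the dual functionals, that is, the cochain with value $1$ on $(e_1,\dots,e_k)$ which vanishes on all $k$-tuples of basis elements that are not a permutation of $(e_1,\dots,e_k)$. Then the cochains $$a^2=C(X,x),\qquad b^3=C(X,xX,x),\qquad a^3=C(X,xX,x^2X)$$ are cocycles of grade $0$ (each vanishes on homogeneous arguments whose grades do not sum to $0$), and up to degree $20$ they are, apart from the constants in degree $0$, the only non-trivial cocycles, up to coboundaries and linear combinations: $\dim H^0(Le(1))=1$, $H^1(Le(1))=0$, the class of $a^2$ is a basis of $H^2(Le(1))$, the classes of $b^3$ and $a^3$ form a basis of $H^3(Le(1))$, and $H^k(Le(1))=0$ for $4\le k\le 20$. Moreover, $a^2$ describes the central extension of $Le(1)$ to $B(1)$: for all $f,g\in B(1)$ the constant term of $\{f,g\}$ equals $-a^2(\bar f,\bar g)$, where $\bar f,\bar g$ are the images of $f,g$ in $Le(1)$. -/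

import Mathlib

namespace Leites

noncomputable section

/-! ## The Buttin superalgebra `B(1)` and the Leites superalgebra `Le(1)` -/

/-- Formal power series `f = f₀ + f₁ X` in one even variable `x` and one odd variable `X`
(`X² = 0`), with coefficients in `K`: the dual numbers over `K⟦x⟧`, `f.fst = f₀`,
`f.snd = f₁`. -/
abbrev Buttin (K : Type*) [Field K] : Type _ := DualNumber (PowerSeries K)

section Algebra

variable (K : Type*) [Field K]

/-- The partial derivative `∂/∂x`, coefficientwise on `f₀ + f₁ X`. -/
def partialEven (f : Buttin K) : Buttin K :=
  TrivSqZeroExt.inl (PowerSeries.derivative K f.fst) +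
    TrivSqZeroExt.inr (PowerSeries.derivative K f.snd)

/-- The partial derivative `∂/∂X`, sending `f₀ + f₁ X` to `f₁`. -/
def partialOdd (f : Buttin K) : Buttin K := TrivSqZeroExt.inl f.snd

/-- The parity involution `f ↦ (-1)^{p(f)} f` of superfunctions, `f₀ + f₁ X ↦ f₀ - f₁ X`. -/
def parityInvolution (f : Buttin K) : Buttin K :=
  TrivSqZeroExt.inl f.fst - TrivSqZeroExt.inr f.snd

/-- The Buttin bracket `{f, g} = ∂f/∂x ∂g/∂X + (-1)^{p(f)} ∂f/∂X ∂g/∂x`. -/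
def buttinBracket : Buttin K →ₗ[K] Buttin K →ₗ[K] Buttin K :=
  LinearMap.mk₂ K
    (fun f g => partialEven K f * partialOdd K g +
      partialOdd K (parityInvolution K f) * partialEven K g)
    (by
      intro f f' g
      ext1 <;> simp [partialEven, partialOdd, parityInvolution] <;> ring)
    (by
      intro c f g
      ext1 <;> simp [partialEven, partialOdd, parityInvolution, PowerSeries.smul_eq_C_mul] <;>
        ring)
    (by
      intro f g g'
      ext1 <;> simp [partialEven, partialOdd, parityInvolution] <;> ring)
    (by
      intro c f g
      ext1 <;> simp [partialEven, partialOdd, parityInvolution, PowerSeries.smul_eq_C_mul] <;>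
        ring)

/-- The center `Z = Span {1}` of `B(1)`. -/
def center : Submodule K (Buttin K) := Submodule.span K {1}

theorem buttinBracket_center_left {z : Buttin K} (hz : z ∈ center K) (g : Buttin K) :
    buttinBracket K z g = 0 := by
  obtain ⟨c, rfl⟩ := Submodule.mem_span_singleton.1 hz
  rw [map_smul, LinearMap.smul_apply]
  have : buttinBracket K 1 g = 0 := by
    ext1 <;> simp [buttinBracket, partialEven, partialOdd, parityInvolution]
  rw [this, smul_zero]

theorem buttinBracket_center_right {z : Buttin K} (hz : z ∈ center K) (f : Buttin K) :
    buttinBracket K f z = 0 := by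
  obtain ⟨c, rfl⟩ := Submodule.mem_span_singleton.1 hz
  rw [map_smul]
  have : buttinBracket K f 1 = 0 := by
    ext1 <;> simp [buttinBracket, partialEven, partialOdd, parityInvolution]
  rw [this, smul_zero]

/-- The Leites superalgebra `Le(1) = B(1)/Z`. -/
abbrev Le : Type _ := Buttin K ⧸ center K

/-- The projection `B(1) → Le(1)`. -/
abbrev toLe : Buttin K →ₗ[K] Le K := (center K).mkQ

/-- The bracket of `Le(1)`, induced by the Buttin bracket. -/
def leBracket : Le K →ₗ[K] Le K →ₗ[K] Le K :=
  (center K).liftQ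
    { toFun := fun f => (center K).liftQ (toLe K ∘ₗ buttinBracket K f) (by
        intro z hz
        simp [buttinBracket_center_right K hz])
      map_add' := by
        intro f f'
        ext g
        simp
      map_smul' := by
        intro c f
        ext g
        simp }
    (by
      intro z hz
      ext g
      simp [buttinBracket_center_left K hz])

theorem leBracket_toLe (f g : Buttin K) :
    leBracket K (toLe K f) (toLe K g) = toLe K (buttinBracket K f g) := rfl

/-- The homogeneous components of the Lie superalgebra `Le(1)`. The parity in the Lie
superalgebra is opposite to that of the generating function: the even part consists of the
classes of `f₁ X`, the odd part of the classes of `f₀`. -/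
def parityPart (p : ZMod 2) : Submodule K (Le K) :=
  if p = 0 then
    LinearMap.range
      (toLe K ∘ₗ (TrivSqZeroExt.inrHom (PowerSeries K) (PowerSeries K)).restrictScalars K)
  else
    LinearMap.range
      (toLe K ∘ₗ (TrivSqZeroExt.inlAlgHom K (PowerSeries K) (PowerSeries K)).toLinearMap)

/-- The classes of the generating functions divisible by `x ^ N`; these subspaces form a basis
of neighbourhoods of zero of the `x`-adic topology of `Le(1)`. -/
def filtration (N : ℕ) : Set (Le K) :=
  {u | ∃ f : Buttin K, toLe K f = u ∧
    ∀ n < N, PowerSeries.coeff n f.fst = 0 ∧ PowerSeries.coeff n f.snd = 0}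

/-- The elements of grade `g` for the grading `g(x) = 1`, `g(X) = -1`: a monomial `x^n` has
grade `n`, a monomial `x^n X` has grade `n - 1`. -/
def gradePart (g : ℤ) : Set (Le K) :=
  {u | ∃ f : Buttin K, toLe K f = u ∧ ∀ n : ℕ,
    (PowerSeries.coeff n f.fst ≠ 0 → (n : ℤ) = g) ∧
    (PowerSeries.coeff n f.snd ≠ 0 → (n : ℤ) - 1 = g)}

end Algebra

/-! ## Cohomology of `Le(1)` in the trivial module `K` -/

section Cohomology

variable (K : Type*) [Field K]

/-- Shortcut to Mathlib's instance, for instance search on subspaces. -/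
instance multilinearAddCommGroup (k : ℕ) :
    AddCommGroup (MultilinearMap K (fun _ : Fin k => Le K) K) :=
  MultilinearMap.instAddCommGroup

/-- The space of `k`-cochains: continuous super skew-symmetric `k`-linear maps
`Le(1) × ⋯ × Le(1) → K`. Transposing two adjacent homogeneous arguments of parities `p, q`
multiplies the value by `-(-1)^{p q}`; continuity for the `x`-adic topology means that the value
depends only on finitely many coefficients of each argument. -/
def cochains (k : ℕ) : Submodule K (MultilinearMap K (fun _ : Fin k => Le K) K) where
  carrier := {C |
    (∀ (i j : Fin k), (i : ℕ) + 1 = j → ∀ (p q : ZMod 2) (u : Fin k → Le K),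
      u i ∈ parityPart K p → u j ∈ parityPart K q →
        C (u ∘ Equiv.swap i j) = -(-1) ^ (p * q).val * C u) ∧
    ∃ N : ℕ, ∀ (u : Fin k → Le K) (i : Fin k), u i ∈ filtration K N → C u = 0}
  zero_mem' := by
    refine ⟨?_, 0, ?_⟩ <;> simp
  add_mem' := by
    rintro C D ⟨hC, N, hN⟩ ⟨hD, M, hM⟩
    refine ⟨fun i j hij p q u hi hj => ?_, max N M, ?_⟩
    · rw [add_apply, add_apply, hC i j hij p q u hi hj,
        hD i j hij p q u hi hj]
      ring
    · rintro u i ⟨f, hf, h⟩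
      rw [add_apply, hN u i ⟨f, hf, fun n hn => h n (lt_max_of_lt_left hn)⟩,
        hM u i ⟨f, hf, fun n hn => h n (lt_max_of_lt_right hn)⟩, add_zero]
  smul_mem' := by
    rintro c C ⟨hC, N, hN⟩
    refine ⟨fun i j hij p q u hi hj => ?_, N, fun u i hi => ?_⟩
    · rw [smul_apply, smul_apply, hC i j hij p q u hi hj,
        smul_eq_mul, smul_eq_mul]
      ring
    · rw [smul_apply, hN u i hi, smul_zero]

/-- The value `dC(u₀, …, u_k)` of the differential of a `k`-cochain on homogeneous arguments
`u₀, …, u_k` of parities `p₀, …, p_k`, for the trivial module: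
`∑_{i < j} (-1)^{j + p_j (p_{i+1} + ⋯ + p_{j-1})}
  C(u₀, …, u_{i-1}, [u_i, u_j], u_{i+1}, …, û_j, …, u_k)`.
For arguments ordered with the even ones first, the sign of the `(i, j)` term is `(-1)^j` if
`u_i`, `u_j` are even, `(-1)^{q+1}` if `u_i` is even and `u_j` is odd (`q + 1` being the number of
even arguments), and `(-1)^{i+1}` if both are odd. -/
def differential {k : ℕ} (C : MultilinearMap K (fun _ : Fin k => Le K) K)
    (p : Fin (k + 1) → ZMod 2) (u : Fin (k + 1) → Le K) : K :=
  ∑ j : Fin (k + 1), ∑ i ∈ Finset.Iio j,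
    (-1) ^ ((j : ℕ) + (p j * ∑ m ∈ Finset.Ioo i j, p m).val) *
      C (j.removeNth (Function.update u i (leBracket K (u i) (u j))))

theorem differential_add {k : ℕ} (C D : MultilinearMap K (fun _ : Fin k => Le K) K)
    (p : Fin (k + 1) → ZMod 2) (u : Fin (k + 1) → Le K) :
    differential K (C + D) p u = differential K C p u + differential K D p u := by
  simp [differential, mul_add, Finset.sum_add_distrib]

theorem differential_smul {k : ℕ} (c : K) (C : MultilinearMap K (fun _ : Fin k => Le K) K)
    (p : Fin (k + 1) → ZMod 2) (u : Fin (k + 1) → Le K) :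
    differential K (c • C) p u = c * differential K C p u := by
  simp only [differential, Finset.mul_sum, smul_apply, smul_eq_mul]
  refine Finset.sum_congr rfl fun j _ => Finset.sum_congr rfl fun i _ => ?_
  ring

/-- The cocycles `Z^k`: the cochains with `dC = 0`. (A multilinear map is determined by its
values on homogeneous arguments.) -/
def cocycles (k : ℕ) : Submodule K (MultilinearMap K (fun _ : Fin k => Le K) K) where
  carrier := {C | C ∈ cochains K k ∧
    ∀ (p : Fin (k + 1) → ZMod 2) (u : Fin (k + 1) → Le K),
      (∀ i, u i ∈ parityPart K (p i)) → differential K C p u = 0}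
  zero_mem' := ⟨zero_mem _, fun p u _ => by simp [differential]⟩
  add_mem' := by
    rintro C D ⟨hC, hC'⟩ ⟨hD, hD'⟩
    refine ⟨add_mem hC hD, fun p u hu => ?_⟩
    rw [differential_add, hC' p u hu, hD' p u hu, add_zero]
  smul_mem' := by
    rintro c C ⟨hC, hC'⟩
    refine ⟨Submodule.smul_mem _ c hC, fun p u hu => ?_⟩
    rw [differential_smul, hC' p u hu, mul_zero]

/-- The coboundaries `B^k`: the `k`-cochains of the form `dD`, with `D` a `(k-1)`-cochain;
`B^0 = 0`. -/
def coboundaries : (k : ℕ) → Submodule K (MultilinearMap K (fun _ : Fin k => Le K) K)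
  | 0 => ⊥
  | k + 1 =>
    { carrier := {C | C ∈ cochains K (k + 1) ∧ ∃ D ∈ cochains K k,
        ∀ (p : Fin (k + 1) → ZMod 2) (u : Fin (k + 1) → Le K),
          (∀ i, u i ∈ parityPart K (p i)) → C u = differential K D p u}
      zero_mem' := ⟨zero_mem _, 0, zero_mem _, fun p u _ => by simp [differential]⟩
      add_mem' := by
        rintro C C' ⟨hC, D, hD, h⟩ ⟨hC', D', hD', h'⟩
        refine ⟨add_mem hC hC', D + D', add_mem hD hD', fun p u hu => ?_⟩
        rw [differential_add, add_apply, h p u hu, h' p u hu]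
      smul_mem' := by
        rintro c C ⟨hC, D, hD, h⟩
        refine ⟨Submodule.smul_mem _ c hC, c • D, Submodule.smul_mem _ c hD, fun p u hu => ?_⟩
        rw [differential_smul, smul_apply, h p u hu, smul_eq_mul] }

/-- The cohomology `H^k(Le(1)) = Z^k / B^k` in the trivial module `K`. -/
abbrev Cohomology (k : ℕ) : Type _ := cocycles K k ⧸ (coboundaries K k).submoduleOf (cocycles K k)

/-- The cohomology class of a cocycle. -/
abbrev cohomologyClass {k : ℕ} (C : MultilinearMap K (fun _ : Fin k => Le K) K)
    (hC : C ∈ cocycles K k) : Cohomology K k :=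
  Submodule.Quotient.mk ⟨C, hC⟩

/-- A cochain has grade `g` if it vanishes on homogeneous arguments whose grades do not sum
to `g`. -/
def HasGrade {k : ℕ} (C : MultilinearMap K (fun _ : Fin k => Le K) K) (g : ℤ) : Prop :=
  ∀ (h : Fin k → ℤ) (u : Fin k → Le K), (∀ i, u i ∈ gradePart K (h i)) → ∑ i, h i ≠ g → C u = 0

end Cohomology

/-! ## The basis cochains -/

section BasisCochains

variable (K : Type*) [Field K]

/-- The linear functional on `Le(1)` dual to `E_i = x^i X`: the coefficient of `x^i X`. -/
def dualE (i : ℕ) : Le K →ₗ[K] K :=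
  (center K).liftQ
    (PowerSeries.coeff i ∘ₗ
      (TrivSqZeroExt.sndHom (PowerSeries K) (PowerSeries K)).restrictScalars K)
    (by
      rw [center, Submodule.span_le]
      rintro _ rfl
      simp)

/-- The linear functional on `Le(1)` dual to `O_i = x^i`, for `i ≥ 1`: the coefficient of
`x^i`. -/
def dualO (i : ℕ) (hi : 1 ≤ i) : Le K →ₗ[K] K :=
  (center K).liftQ
    (PowerSeries.coeff i ∘ₗ (TrivSqZeroExt.fstHom K (PowerSeries K) (PowerSeries K)).toLinearMap)
    (by
      rw [center, Submodule.span_le]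
      rintro _ rfl
      simp [PowerSeries.coeff_one, Nat.one_le_iff_ne_zero.1 hi])

/-- The exterior product `φ₁ ∧ ⋯ ∧ φ_k` of linear functionals, of which at most one does not
vanish on the odd part of `Le(1)` (then no further signs arise):
`(u₁, …, u_k) ↦ ∑_σ sign(σ) ∏ φ_i(u_{σ(i)})`. -/
def wedge {k : ℕ} (φ : Fin k → Le K →ₗ[K] K) : MultilinearMap K (fun _ : Fin k => Le K) K :=
  (MultilinearMap.alternatization
    ((MultilinearMap.mkPiAlgebra K (Fin k) K).compLinearMap φ)).toMultilinearMap

/-- The cochain `a² = C(X, x)`. -/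
def a2 : MultilinearMap K (fun _ : Fin 2 => Le K) K :=
  wedge K ![dualE K 0, dualO K 1 le_rfl]

/-- The cochain `b³ = C(X, xX, x)`. -/
def b3 : MultilinearMap K (fun _ : Fin 3 => Le K) K :=
  wedge K ![dualE K 0, dualE K 1, dualO K 1 le_rfl]

/-- The cochain `a³ = C(X, xX, x²X)`. -/
def a3 : MultilinearMap K (fun _ : Fin 3 => Le K) K :=
  wedge K ![dualE K 0, dualE K 1, dualE K 2]

end BasisCochains

end

end Leites

/-! The even element `xX` acts on `Le(1)` diagonally: a basis element of grade `g` is an eigenvector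
with eigenvalue `-g`. By Cartan's formula, the induced action on cochains is homotopic to zero
through contraction with `xX` (`differential_cons_euler`), so it sends cocycles to coboundaries
(`lieDerivative_mem_coboundaries`). On tuples of basis elements of total grade `g` it is
multiplication by `-g`, invertible for `g ≠ 0` in characteristic zero. A continuous cochain involves
only finitely many total grades, and these can be removed one at a time; hence every cocycle of
positive degree is cohomologous to one of grade zero (`exists_supportedInGrades_zero`).

Cochains of grade zero are very few. The only basis element of negative grade is `X`, of grade `-1`,
and the only one of grade zero is `xX`. Both are even, so neither can occur twice in a tuple with
nonzero value. In degree at least two such a tuple must therefore contain `X` once, and its other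
grades are non-negative with sum one: a single entry of grade one, namely `x` or `x²X`, and at most
one `xX` (`eq_zero_of_apply_cons`). Nothing remains from degree four on (`eq_zero_of_four_le`),
which gives vanishing with no upper bound on the degree.

What remains is `C(xX)` in degree one, `C(X, x)` and `C(X, x²X)` in degree two, and `b³` and `a³` in
degree three. The differential of `C(xX)` is twice `C(X, x²X)`, so these two contribute nothing to
cohomology. The other three are cocycles, and evaluation at `(X, x)`, `(X, xX, x)` and `(X, xX,
x²X)` vanishes on coboundaries, so it detects their classes. -/

namespace Leites

/-! ### Coordinates, basis elements, and density of their span -/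

section Basics

variable {K : Type*} [Field K]

theorem buttinBracket_fst (f g : Buttin K) :
    (buttinBracket K f g).fst =
      PowerSeries.derivative K f.fst * g.snd - f.snd * PowerSeries.derivative K g.fst := by
  simp [buttinBracket, partialEven, partialOdd, parityInvolution, sub_eq_add_neg]

theorem buttinBracket_snd (f g : Buttin K) :
    (buttinBracket K f g).snd =
      PowerSeries.derivative K f.snd * g.snd - f.snd * PowerSeries.derivative K g.snd := by
  simp [buttinBracket, partialEven, partialOdd, parityInvolution, sub_eq_add_neg, mul_comm]

@[simp] theorem dualE_toLe (i : ℕ) (f : Buttin K) :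
    dualE K i (toLe K f) = PowerSeries.coeff i f.snd := rfl

@[simp] theorem dualO_toLe (i : ℕ) (hi : 1 ≤ i) (f : Buttin K) :
    dualO K i hi (toLe K f) = PowerSeries.coeff i f.fst := rfl

theorem mem_parityPart_zero {u : Le K} :
    u ∈ parityPart K 0 ↔ ∃ f : PowerSeries K, toLe K (TrivSqZeroExt.inr f) = u := by
  simp [parityPart, LinearMap.mem_range]

theorem mem_parityPart_one {u : Le K} :
    u ∈ parityPart K 1 ↔ ∃ f : PowerSeries K, toLe K (TrivSqZeroExt.inl f) = u := by
  simp [parityPart, LinearMap.mem_range]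

/-- The elements `E_i = x^i X` (index `inl i`) and `O_{i+1} = x^{i+1}` (index `inr i`). -/
noncomputable def basisElt (K : Type*) [Field K] : ℕ ⊕ ℕ → Le K
  | .inl i => toLe K (TrivSqZeroExt.inr (PowerSeries.X ^ i))
  | .inr i => toLe K (TrivSqZeroExt.inl (PowerSeries.X ^ (i + 1)))

/-- The grade of a basis element. -/
def basisGrade : ℕ ⊕ ℕ → ℤ
  | .inl i => i - 1
  | .inr i => i + 1

/-- The parity of a basis element. -/
def basisParity : ℕ ⊕ ℕ → ZMod 2
  | .inl _ => 0
  | .inr _ => 1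

theorem basisElt_mem_parityPart (b : ℕ ⊕ ℕ) : basisElt K b ∈ parityPart K (basisParity b) := by
  cases b
  · exact mem_parityPart_zero.2 ⟨_, rfl⟩
  · exact mem_parityPart_one.2 ⟨_, rfl⟩

theorem basisElt_mem_filtration {N : ℕ} {b : ℕ ⊕ ℕ} (h : N ≤ basisGrade b) :
    basisElt K b ∈ filtration K N := by
  cases b with
  | inl i =>
    refine ⟨_, rfl, fun n hn => ?_⟩
    have : n ≠ i := by simp only [basisGrade] at h; omega
    simp [PowerSeries.coeff_X_pow, this]
  | inr i =>
    refine ⟨_, rfl, fun n hn => ?_⟩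
    have : n ≠ i + 1 := by simp only [basisGrade] at h; omega
    simp [PowerSeries.coeff_X_pow, this]

theorem coeff_powerSeries_sub_sum (f : PowerSeries K) {n N : ℕ} (h : n < N) :
    PowerSeries.coeff n (f - ∑ i ∈ Finset.range N, PowerSeries.coeff i f • PowerSeries.X ^ i)
      = 0 := by
  simp [map_sum, PowerSeries.coeff_X_pow, Finset.sum_ite_eq, h]

/-- The monomials alone do not span, since the series are infinite. Truncating both components below
`x ^ N` leaves a remainder in the filtration, on which a continuous cochain vanishes for suitable
`N`. -/
theorem span_basisElt_union_filtration (N : ℕ) :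
    Submodule.span K (Set.range (basisElt K) ∪ filtration K N) = ⊤ := by
  refine eq_top_iff.2 fun u _ => ?_
  obtain ⟨f, rfl⟩ := (center K).mkQ_surjective u
  set S := Submodule.span K (Set.range (basisElt K) ∪ filtration K N) with hS
  have hE : ∀ i, toLe K (TrivSqZeroExt.inr (PowerSeries.X ^ i)) ∈ S := fun i =>
    Submodule.subset_span (Or.inl ⟨.inl i, rfl⟩)
  -- The monomial `x ^ 0 = 1` is not among the basis elements; it is zero in the quotient by the
  -- center.
  have hO : ∀ i, toLe K (TrivSqZeroExt.inl (PowerSeries.X ^ i)) ∈ S := fun i => by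
    cases i with
    | zero =>
      have : toLe K (TrivSqZeroExt.inl (PowerSeries.X ^ 0)) = 0 := by
        rw [pow_zero, Submodule.mkQ_apply, Submodule.Quotient.mk_eq_zero]
        exact Submodule.mem_span_singleton_self _
      rw [this]
      exact zero_mem _
    | succ i => exact Submodule.subset_span (Or.inl ⟨.inr i, rfl⟩)
  have key : f = (∑ i ∈ Finset.range N, PowerSeries.coeff i f.fst •
        (TrivSqZeroExt.inl (PowerSeries.X ^ i) : Buttin K) +
      ∑ i ∈ Finset.range N, PowerSeries.coeff i f.snd •
        (TrivSqZeroExt.inr (PowerSeries.X ^ i) : Buttin K)) +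
      (TrivSqZeroExt.inl (f.fst - ∑ i ∈ Finset.range N,
        PowerSeries.coeff i f.fst • PowerSeries.X ^ i) +
      TrivSqZeroExt.inr (f.snd - ∑ i ∈ Finset.range N,
        PowerSeries.coeff i f.snd • PowerSeries.X ^ i)) := by
    ext1 <;> simp [TrivSqZeroExt.fst_sum, TrivSqZeroExt.snd_sum]
  rw [key, map_add, map_add, map_sum, map_sum]
  refine add_mem (add_mem (sum_mem fun i _ => ?_) (sum_mem fun i _ => ?_)) ?_
  · rw [map_smul]
    exact S.smul_mem _ (hO i)
  · rw [map_smul]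
    exact S.smul_mem _ (hE i)
  · refine Submodule.subset_span (Or.inr ⟨_, rfl, fun n hn => ⟨?_, ?_⟩⟩)
    · simpa using coeff_powerSeries_sub_sum f.fst hn
    · simpa using coeff_powerSeries_sub_sum f.snd hn

/-- Induction on the set `s` of slots whose arguments are unrestricted: freeing one more slot uses
linearity in that slot alone. -/
theorem multilinearMap_eq_zero_of_span {R M N ι : Type*} [CommSemiring R] [AddCommMonoid M]
    [AddCommMonoid N] [Module R M] [Module R N] [Fintype ι] [DecidableEq ι] {S : Set M}
    (hS : Submodule.span R S = ⊤) (C : MultilinearMap R (fun _ : ι => M) N)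
    (h : ∀ u : ι → M, (∀ i, u i ∈ S) → C u = 0) : C = 0 := by
  suffices H : ∀ (s : Finset ι) (u : ι → M), (∀ i ∉ s, u i ∈ S) → C u = 0 by
    ext u
    exact H Finset.univ u (by simp)
  intro s
  induction s using Finset.induction_on with
  | empty => exact fun u hu => h u fun i => hu i (by simp)
  | insert a s ha ih =>
    intro u hu
    have hz : ∀ x : M, C (Function.update u a x) = 0 := by
      intro x
      have hx : x ∈ Submodule.span R S := hS ▸ Submodule.mem_top
      induction hx using Submodule.span_induction with
      | mem x hx =>
        refine ih _ fun i hi => ?_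
        by_cases hia : i = a
        · subst hia
          simpa using hx
        · rw [Function.update_of_ne hia]
          exact hu i (by simp [hia, hi])
      | zero => exact C.map_update_zero u a
      | add x y _ _ hx hy => rw [C.map_update_add, hx, hy, add_zero]
      | smul c x _ hx => rw [C.map_update_smul, hx, smul_zero]
    simpa using hz (u a)

/-- A cochain is determined by its values on the basis elements. -/
theorem eq_zero_of_basisElt {k : ℕ} {C : MultilinearMap K (fun _ : Fin k => Le K) K}
    (hC : C ∈ cochains K k) (h : ∀ b : Fin k → ℕ ⊕ ℕ, C (fun i => basisElt K (b i)) = 0) :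
    C = 0 := by
  obtain ⟨-, N, hN⟩ := hC
  refine multilinearMap_eq_zero_of_span (span_basisElt_union_filtration N) C fun u hu => ?_
  by_cases hf : ∃ i, u i ∈ filtration K N
  · obtain ⟨i, hi⟩ := hf
    exact hN u i hi
  · have : ∀ i, ∃ b, basisElt K b = u i := fun i =>
      (hu i).resolve_right fun hi => hf ⟨i, hi⟩
    choose b hb using this
    rw [← h b]
    congr 1
    ext1 i
    exact (hb i).symm

end Basics

end Leites

namespace Leites

/-! ### The adjoint action of `xX` -/

section Euler

variable {K : Type*} [Field K]

/-- The class of `xX`, whose adjoint action defines the grading. -/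
noncomputable abbrev euler (K : Type*) [Field K] : Le K := basisElt K (.inl 1)

theorem euler_bracket_toLe (f : Buttin K) :
    leBracket K (euler K) (toLe K f) =
      toLe K (TrivSqZeroExt.inl (-(PowerSeries.X * PowerSeries.derivative K f.fst)) +
        TrivSqZeroExt.inr (f.snd - PowerSeries.X * PowerSeries.derivative K f.snd)) := by
  rw [euler, basisElt, leBracket_toLe]
  congr 1
  ext1
  · simp [buttinBracket_fst]
  · simp [buttinBracket_snd]

theorem coeff_X_mul_derivative (f : PowerSeries K) (n : ℕ) :
    PowerSeries.coeff n (PowerSeries.X * PowerSeries.derivative K f) =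
      n * PowerSeries.coeff n f := by
  cases n with
  | zero => simp
  | succ n =>
    rw [PowerSeries.coeff_succ_X_mul, PowerSeries.coeff_derivative]
    push_cast
    ring

theorem euler_bracket_basisElt (b : ℕ ⊕ ℕ) :
    leBracket K (euler K) (basisElt K b) = (-(basisGrade b : ℤ) : K) • basisElt K b := by
  cases b with
  | inl i =>
    rw [basisElt, euler_bracket_toLe, ← map_smul]
    congr 1
    ext1
    · simp
    · ext n
      simp only [TrivSqZeroExt.snd_add, TrivSqZeroExt.snd_inl, TrivSqZeroExt.snd_inr, map_sub,
        TrivSqZeroExt.snd_smul, zero_add, coeff_X_mul_derivative, PowerSeries.coeff_smul,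
        PowerSeries.coeff_X_pow, basisGrade, smul_eq_mul]
      split_ifs with h
      · subst h
        push_cast
        ring
      · simp
  | inr i =>
    rw [basisElt, euler_bracket_toLe, ← map_smul]
    congr 1
    ext1
    · ext n
      simp only [TrivSqZeroExt.fst_add, TrivSqZeroExt.fst_inl, TrivSqZeroExt.fst_inr, map_neg,
        TrivSqZeroExt.fst_smul, add_zero, coeff_X_mul_derivative, PowerSeries.coeff_smul,
        PowerSeries.coeff_X_pow, basisGrade, smul_eq_mul]
      split_ifs with h
      · subst h
        push_cast
        ring
      · simp
    · simp

theorem euler_bracket_mem_parityPart {p : ZMod 2} {u : Le K} (hu : u ∈ parityPart K p) :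
    leBracket K (euler K) u ∈ parityPart K p := by
  obtain rfl | rfl : p = 0 ∨ p = 1 := (by decide : ∀ q : ZMod 2, q = 0 ∨ q = 1) p
  · obtain ⟨f, rfl⟩ := mem_parityPart_zero.1 hu
    refine mem_parityPart_zero.2 ⟨f - PowerSeries.X * PowerSeries.derivative K f, ?_⟩
    rw [euler_bracket_toLe]
    congr 1
    ext1 <;> simp
  · obtain ⟨f, rfl⟩ := mem_parityPart_one.1 hu
    refine mem_parityPart_one.2 ⟨-(PowerSeries.X * PowerSeries.derivative K f), ?_⟩
    rw [euler_bracket_toLe]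
    congr 1
    ext1 <;> simp

theorem euler_bracket_mem_filtration {N : ℕ} {u : Le K} (hu : u ∈ filtration K N) :
    leBracket K (euler K) u ∈ filtration K N := by
  obtain ⟨f, rfl, hf⟩ := hu
  refine ⟨_, (euler_bracket_toLe f).symm, fun n hn => ⟨?_, ?_⟩⟩
  · simp [coeff_X_mul_derivative, (hf n hn).1]
  · simp [coeff_X_mul_derivative, (hf n hn).2]

/-- The only instance of the Jacobi identity that is needed. As `xX` is even, it carries no sign. -/
theorem euler_bracket_leBracket (u v : Le K) :
    leBracket K (euler K) (leBracket K u v) =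
      leBracket K (leBracket K (euler K) u) v + leBracket K u (leBracket K (euler K) v) := by
  obtain ⟨f, rfl⟩ := (center K).mkQ_surjective u
  obtain ⟨g, rfl⟩ := (center K).mkQ_surjective v
  rw [euler_bracket_toLe, euler_bracket_toLe, leBracket_toLe, leBracket_toLe, leBracket_toLe,
    euler_bracket_toLe, ← map_add]
  congr 1
  ext1
  · simp [buttinBracket_fst, buttinBracket_snd]
    ring
  · simp [buttinBracket_snd]
    ring

end Euler

/-! ### The action of `xX` on cochains -/

section LieDerivative

variable {K : Type*} [Field K]

/-- The action of `xX` on multilinear forms,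
`C ↦ ((u₁, …, u_k) ↦ ∑ C(u₁, …, [xX, u_i], …, u_k))`. -/
noncomputable def lieDerivative {k : ℕ} (C : MultilinearMap K (fun _ : Fin k => Le K) K) :
    MultilinearMap K (fun _ : Fin k => Le K) K :=
  ∑ i : Fin k, C.compLinearMap
    (Function.update (fun _ => LinearMap.id) i (leBracket K (euler K)))

theorem lieDerivative_apply {k : ℕ} (C : MultilinearMap K (fun _ : Fin k => Le K) K)
    (u : Fin k → Le K) :
    lieDerivative C u = ∑ i, C (Function.update u i (leBracket K (euler K) (u i))) := by
  rw [lieDerivative, sum_apply]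
  refine Finset.sum_congr rfl fun i _ => ?_
  rw [MultilinearMap.compLinearMap_apply]
  congr 1
  ext1 j
  by_cases h : j = i
  · subst h
    simp
  · simp [h]

theorem update_mem_parityPart {k : ℕ} {p : Fin k → ZMod 2} {u : Fin k → Le K}
    (hu : ∀ i, u i ∈ parityPart K (p i)) (m i : Fin k) :
    Function.update u m (leBracket K (euler K) (u m)) i ∈ parityPart K (p i) := by
  by_cases h : i = m
  · subst h
    simpa using euler_bracket_mem_parityPart (hu i)
  · simpa [h] using hu i

theorem lieDerivative_mem_cochains {k : ℕ} {C : MultilinearMap K (fun _ : Fin k => Le K) K}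
    (hC : C ∈ cochains K k) : lieDerivative C ∈ cochains K k := by
  obtain ⟨hs, N, hN⟩ := hC
  refine ⟨fun i j hij p q u hi hj => ?_, N, fun u i hi => ?_⟩
  · rw [lieDerivative_apply, lieDerivative_apply, Finset.mul_sum,
      ← Equiv.sum_comp (Equiv.swap i j)]
    refine Finset.sum_congr rfl fun m _ => ?_
    -- Acting in slot `swap i j m` of the swapped tuple is the same as acting in slot `m` and then
    -- swapping; this is why the sum was reindexed by the transposition.
    have key : Function.update (u ∘ Equiv.swap i j) (Equiv.swap i j m)
        (leBracket K (euler K) ((u ∘ Equiv.swap i j) (Equiv.swap i j m))) =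
        Function.update u m (leBracket K (euler K) (u m)) ∘ Equiv.swap i j := by
      ext1 l
      simp only [Function.comp_apply, Equiv.swap_apply_self, Function.update_apply]
      by_cases h : l = Equiv.swap i j m
      · simp [h]
      · have : ¬ Equiv.swap i j l = m := fun hl => h (by simp [← hl])
        simp [h, this]
    rw [key]
    refine hs i j hij p q _ ?_ ?_
    · by_cases h : i = m
      · subst h
        simpa using euler_bracket_mem_parityPart hi
      · simpa [h] using hi
    · by_cases h : j = m
      · subst h
        simpa using euler_bracket_mem_parityPart hj
      · simpa [h] using hj
  · rw [lieDerivative_apply]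
    refine Finset.sum_eq_zero fun m _ => hN _ i ?_
    by_cases h : i = m
    · subst h
      simpa using euler_bracket_mem_filtration hi
    · simpa [h] using hi

theorem lieDerivative_basisElt {k : ℕ} (C : MultilinearMap K (fun _ : Fin k => Le K) K)
    (b : Fin k → ℕ ⊕ ℕ) :
    lieDerivative C (fun i => basisElt K (b i)) =
      -((∑ i, basisGrade (b i) : ℤ) : K) * C (fun i => basisElt K (b i)) := by
  rw [lieDerivative_apply, Int.cast_sum, ← Finset.sum_neg_distrib, Finset.sum_mul]
  refine Finset.sum_congr rfl fun i _ => ?_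
  rw [euler_bracket_basisElt, C.map_update_smul, Function.update_eq_self, smul_eq_mul]

/-- The action commutes with `d` because `ad (xX)` is an even derivation. The signs depend only on
parities, which do not change, so the identity can be checked for each pair `i < j` separately. -/
theorem differential_lieDerivative {k : ℕ} (C : MultilinearMap K (fun _ : Fin k => Le K) K)
    (p : Fin (k + 1) → ZMod 2) (u : Fin (k + 1) → Le K) :
    differential K (lieDerivative C) p u =
      ∑ m, differential K C p (Function.update u m (leBracket K (euler K) (u m))) := by
  simp only [differential]
  rw [Finset.sum_comm]
  refine Finset.sum_congr rfl fun j _ => ?_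
  rw [Finset.sum_comm]
  refine Finset.sum_congr rfl fun i hi => ?_
  rw [← Finset.mul_sum]
  congr 1
  have hij : i ≠ j := (Finset.mem_Iio.1 hi).ne
  obtain ⟨l, rfl⟩ := Fin.exists_succAbove_eq hij
  rw [Fin.sum_univ_succAbove _ j, lieDerivative_apply]
  simp only [Fin.removeNth_update_succAbove, Fin.removeNth_update, Function.update_self]
  -- Isolate the slot `l` that holds `[u_i, u_j]`: there the derivation property matches one term on
  -- the left with the terms `m = i` and `m = j` on the right. The remaining slots agree one by one.
  rw [← Finset.add_sum_erase _ _ (Finset.mem_univ l), ← Finset.add_sum_erase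
    (s := Finset.univ) (a := l) _ (Finset.mem_univ l), ← add_assoc]
  congr 1
  · simp only [Function.update_self, Function.update_idem,
      Function.update_of_ne hij, Function.update_of_ne hij.symm]
    rw [euler_bracket_leBracket, C.map_update_add, add_comm]
  · refine Finset.sum_congr rfl fun m hm => ?_
    have hml : m ≠ l := Finset.ne_of_mem_erase hm
    have hml' : j.succAbove l ≠ j.succAbove m := fun h => hml (Fin.succAbove_right_injective h).symm
    rw [Function.update_of_ne hml, Function.update_of_ne hml',
      Function.update_of_ne (Fin.succAbove_ne j m).symm, Function.update_comm hml]
    rfl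

theorem lieDerivative_mem_cocycles {k : ℕ} {C : MultilinearMap K (fun _ : Fin k => Le K) K}
    (hC : C ∈ cocycles K k) : lieDerivative C ∈ cocycles K k := by
  refine ⟨lieDerivative_mem_cochains hC.1, fun p u hu => ?_⟩
  rw [differential_lieDerivative]
  exact Finset.sum_eq_zero fun m _ => hC.2 p _ (update_mem_parityPart hu m)

end LieDerivative

end Leites

namespace Leites

/-! ### Cartan's formula and reduction to grade zero -/

section Contraction

variable {K : Type*} [Field K]

theorem neg_one_pow_val_add (a b : ZMod 2) :
    (-1 : K) ^ (a + b).val = (-1) ^ a.val * (-1) ^ b.val := by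
  obtain rfl | rfl : a = 0 ∨ a = 1 := (by decide : ∀ q : ZMod 2, q = 0 ∨ q = 1) a
  · simp
  · obtain rfl | rfl : b = 0 ∨ b = 1 := (by decide : ∀ q : ZMod 2, q = 0 ∨ q = 1) b
    · simp
    · rw [show (1 + 1 : ZMod 2) = 0 by decide]
      simp [ZMod.val_one]

theorem insertNth_comp_swap {α : Type*} {k : ℕ} (j : Fin k) (x : α) (w : Fin k → α) :
    (j.succ.insertNth x w : Fin (k + 1) → α) ∘ Equiv.swap j.castSucc j.succ =
      j.castSucc.insertNth x w := by
  ext1 i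
  rw [Function.comp_apply]
  induction i using Fin.succAboveCases j.castSucc with
  | x => simp
  | p m =>
    rw [Fin.insertNth_apply_succAbove]
    by_cases hm : m = j
    · subst hm
      rw [Fin.succAbove_castSucc_self, Equiv.swap_apply_right]
      conv_lhs => rw [← Fin.succAbove_succ_self m, Fin.insertNth_apply_succAbove]
    · have h : j.castSucc.succAbove m = j.succ.succAbove m := by
        rcases lt_or_gt_of_ne hm with h | h
        · rw [Fin.succAbove_castSucc_of_lt _ _ h, Fin.succAbove_succ_of_le _ _ h.le]
        · rw [Fin.succAbove_castSucc_of_le _ _ h.le, Fin.succAbove_succ_of_lt _ _ h]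
      rw [Equiv.swap_apply_of_ne_of_ne (Fin.succAbove_ne _ _)
        (h ▸ Fin.succAbove_ne _ _), h, Fin.insertNth_apply_succAbove]

/-- Moving the first argument of a cochain to position `j`. -/
theorem apply_insertNth {k : ℕ} {C : MultilinearMap K (fun _ : Fin (k + 1) => Le K) K}
    (hC : C ∈ cochains K (k + 1)) {p : ZMod 2} {x : Le K} (hx : x ∈ parityPart K p)
    {q : Fin k → ZMod 2} {w : Fin k → Le K} (hw : ∀ i, w i ∈ parityPart K (q i))
    (j : Fin (k + 1)) :
    C (Fin.cons x w) =
      (-1) ^ ((j : ℕ) + (p * ∑ m : Fin k with m.castSucc < j, q m).val) *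
        C (j.insertNth x w) := by
  induction j using Fin.induction with
  | zero => simp
  | succ j ih =>
    have hsum : ∑ m : Fin k with m.castSucc < j.succ, q m =
        q j + ∑ m : Fin k with m.castSucc < j.castSucc, q m := by
      rw [← Finset.sum_insert (by simp)]
      refine Finset.sum_congr ?_ fun _ _ => rfl
      ext m
      simp [Fin.castSucc_lt_succ_iff, le_iff_eq_or_lt]
    -- One adjacent transposition moves `x` past `w j`, adding one to the exponent for skew symmetry
    -- and `p * q j` for the parities.
    have hswap := hC.1 j.castSucc j.succ (by simp) (q j) p (j.succ.insertNth x w)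
      (by
        have h : (j.succ.insertNth x w : Fin (k + 1) → Le K) j.castSucc = w j := by
          conv_lhs => rw [← Fin.succAbove_succ_self j, Fin.insertNth_apply_succAbove]
        rw [h]
        exact hw j)
      (by simpa using hx)
    rw [insertNth_comp_swap] at hswap
    rw [ih, hswap, hsum, mul_add, pow_add, pow_add, neg_one_pow_val_add, Fin.val_succ, pow_succ,
      Fin.val_castSucc, mul_comm p (q j)]
    ring

theorem Iio_succ_eq_insert {n : ℕ} (j : Fin n) :
    Finset.Iio j.succ = insert 0 ((Finset.Iio j).map (Fin.succEmb n)) := by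
  ext i
  cases i using Fin.cases <;> simp

theorem Ioo_succ_succ_eq_map {n : ℕ} (i j : Fin n) :
    Finset.Ioo i.succ j.succ = (Finset.Ioo i j).map (Fin.succEmb n) := by
  ext i
  cases i using Fin.cases <;> simp

theorem Ioo_zero_succ_eq_map {n : ℕ} (j : Fin n) :
    Finset.Ioo 0 j.succ = (Finset.Iio j).map (Fin.succEmb n) := by
  ext i
  cases i using Fin.cases <;> simp

theorem removeNth_succ_cons {α : Type*} {n : ℕ} (j : Fin (n + 1)) (x : α) (u : Fin (n + 1) → α) :
    j.succ.removeNth (Fin.cons x u : Fin (n + 2) → α) = Fin.cons x (j.removeNth u) := by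
  ext i
  cases i using Fin.cases <;> simp [Fin.removeNth]

theorem sum_filter_castSucc_lt {M : Type*} [AddCommMonoid M] {n : ℕ} (j : Fin (n + 1))
    (p : Fin (n + 1) → M) :
    ∑ m : Fin n with m.castSucc < j, p (j.succAbove m) = ∑ m ∈ Finset.Iio j, p m := by
  have : Finset.Iio j = (Finset.univ.filter fun m : Fin n => m.castSucc < j).map
      j.succAboveEmb := by
    ext i
    simp only [Finset.mem_Iio, Finset.mem_map, Finset.mem_filter, Finset.mem_univ, true_and,
      Fin.coe_succAboveEmb]
    constructor
    · intro h
      obtain ⟨l, rfl⟩ := Fin.exists_succAbove_eq h.ne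
      exact ⟨l, by rwa [Fin.succAbove_lt_iff_castSucc_lt] at h, rfl⟩
    · rintro ⟨m, hm, rfl⟩
      rwa [Fin.succAbove_lt_iff_castSucc_lt]
  rw [this, Finset.sum_map]
  rfl

/-- Cartan's formula for the contraction with `xX`. -/
theorem differential_cons_euler {k : ℕ}
    {C : MultilinearMap K (fun _ : Fin (k + 1) => Le K) K} (hC : C ∈ cochains K (k + 1))
    {p : Fin (k + 1) → ZMod 2} {u : Fin (k + 1) → Le K} (hu : ∀ i, u i ∈ parityPart K (p i)) :
    differential K C (Fin.cons 0 p) (Fin.cons (euler K) u) =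
      -lieDerivative C u - differential K (C.curryLeft (euler K)) p u := by
  rw [differential, Fin.sum_univ_succ, lieDerivative_apply, differential,
    ← Finset.sum_neg_distrib, ← Finset.sum_sub_distrib]
  rw [show Finset.Iio (0 : Fin (k + 2)) = ∅ from by ext; simp, Finset.sum_empty, zero_add]
  refine Finset.sum_congr rfl fun j _ => ?_
  rw [Iio_succ_eq_insert, Finset.sum_insert (by simp), Finset.sum_map, sub_eq_add_neg,
    ← Finset.sum_neg_distrib]
  congr 1
  · simp only [Fin.cons_zero, Fin.cons_succ, Ioo_zero_succ_eq_map, Finset.sum_map,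
      Fin.coe_succEmb]
    -- The pairs `(0, j + 1)` give the Lie derivative: `[xX, u_j]` stands in front and is carried
    -- back to slot `j`. The sign of this move equals the sign in the differential except for the
    -- shift from `j` to `j + 1`, which leaves `-1`.
    rw [Fin.update_cons_zero, removeNth_succ_cons,
      apply_insertNth hC (euler_bracket_mem_parityPart (hu j)) (q := fun m => p (j.succAbove m))
        (w := j.removeNth u) (fun m => hu _) j, sum_filter_castSucc_lt, Fin.insertNth_removeNth,
      ← mul_assoc, ← pow_add]
    have : ((-1 : K) ^ ((j.succ : ℕ) + (p j * ∑ m ∈ Finset.Iio j, p m).val +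
        ((j : ℕ) + (p j * ∑ m ∈ Finset.Iio j, p m).val))) = -1 := by
      refine Odd.neg_one_pow ⟨(j : ℕ) + (p j * ∑ m ∈ Finset.Iio j, p m).val, ?_⟩
      rw [Fin.val_succ]
      ring
    rw [this, neg_one_mul]
  -- The pairs not involving `xX` reproduce the differential of the contraction, with the opposite
  -- sign because `j` has become `j + 1`.
  · refine Finset.sum_congr rfl fun i _ => ?_
    simp only [Fin.cons_succ, Ioo_succ_succ_eq_map, Finset.sum_map, Fin.coe_succEmb]
    rw [← Fin.cons_update, removeNth_succ_cons, MultilinearMap.curryLeft_apply, Fin.val_succ,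
      add_right_comm, pow_succ]
    ring

theorem curryLeft_mem_cochains {k : ℕ} {C : MultilinearMap K (fun _ : Fin (k + 1) => Le K) K}
    (hC : C ∈ cochains K (k + 1)) (x : Le K) : C.curryLeft x ∈ cochains K k := by
  obtain ⟨hs, N, hN⟩ := hC
  refine ⟨fun i j hij p q u hi hj => ?_, N, fun u i hi => ?_⟩
  · have := hs i.succ j.succ (by simp [hij]) p q (Fin.cons x u) (by simpa using hi)
      (by simpa using hj)
    rw [MultilinearMap.curryLeft_apply, MultilinearMap.curryLeft_apply, ← this]
    congr 1
    ext1 m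
    cases m using Fin.cases with
    | zero =>
      rw [Function.comp_apply, Equiv.swap_apply_of_ne_of_ne (Fin.succ_ne_zero _).symm
        (Fin.succ_ne_zero _).symm]
      rfl
    | succ m =>
      rw [Function.comp_apply, Fin.cons_succ, Function.comp_apply,
        ← (Fin.succ_injective k).map_swap i j m, Fin.cons_succ]
  · rw [MultilinearMap.curryLeft_apply]
    exact hN _ i.succ (by simpa using hi)

/-- When `dC = 0`, Cartan's formula exhibits minus the contraction of `C` with `xX` as a primitive
of the Lie derivative. -/
theorem lieDerivative_mem_coboundaries {k : ℕ}
    {C : MultilinearMap K (fun _ : Fin (k + 1) => Le K) K} (hC : C ∈ cocycles K (k + 1)) :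
    lieDerivative C ∈ coboundaries K (k + 1) := by
  refine ⟨lieDerivative_mem_cochains hC.1, -C.curryLeft (euler K),
    neg_mem (curryLeft_mem_cochains hC.1 _), fun p u hu => ?_⟩
  have h := hC.2 (Fin.cons 0 p) (Fin.cons (euler K) u) (by
    intro i
    cases i using Fin.cases with
    | zero => exact (basisElt_mem_parityPart (.inl 1) : euler K ∈ parityPart K 0)
    | succ i => simpa using hu i)
  rw [differential_cons_euler hC.1 hu] at h
  rw [← neg_one_smul K, differential_smul, neg_one_mul]
  linear_combination -h

/-- A form vanishing on all tuples of basis elements whose grades do not sum to an element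
of `G`. -/
def SupportedInGrades {k : ℕ} (C : MultilinearMap K (fun _ : Fin k => Le K) K)
    (G : Finset ℤ) : Prop :=
  ∀ b : Fin k → ℕ ⊕ ℕ, ∑ i, basisGrade (b i) ∉ G → C (fun i => basisElt K (b i)) = 0

/-- Induction on the grades to be removed. Adding `g⁻¹` times the Lie derivative changes `C` by a
coboundary, multiplies the part of grade `h` by `1 - h / g`, and so kills grade `g` without creating
any new grade or altering the part of grade zero. -/
theorem exists_supportedInGrades_zero_of_insert [CharZero K] {k : ℕ} (G : Finset ℤ)
    {C : MultilinearMap K (fun _ : Fin (k + 1) => Le K) K} (hC : C ∈ cocycles K (k + 1))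
    (hG : SupportedInGrades C (insert 0 G)) :
    ∃ C₀ ∈ cocycles K (k + 1), SupportedInGrades C₀ {0} ∧ C - C₀ ∈ coboundaries K (k + 1) := by
  induction G using Finset.induction_on generalizing C with
  | empty => exact ⟨C, hC, by simpa using hG, by simp⟩
  | insert g G hgG ih =>
    by_cases hg : g = 0
    · exact ih hC (by simpa [hg] using hG)
    · have hg' : (g : K) ≠ 0 := by exact_mod_cast hg
      have hL := Submodule.smul_mem _ (g : K)⁻¹ (lieDerivative_mem_coboundaries hC)
      obtain ⟨C₀, h₀, hs, hb⟩ := ih (C := C + (g : K)⁻¹ • lieDerivative C)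
        (add_mem hC (Submodule.smul_mem _ _ (lieDerivative_mem_cocycles hC)))
        (by
          intro b hb
          rw [add_apply, smul_apply, lieDerivative_basisElt, smul_eq_mul]
          by_cases hbg : ∑ i, basisGrade (b i) = g
          · rw [hbg]
            field_simp
            ring
          · rw [hG b (by simp only [Finset.mem_insert] at hb ⊢; tauto)]
            simp)
      refine ⟨C₀, h₀, hs, ?_⟩
      have := sub_mem hb hL
      rwa [show C + (g : K)⁻¹ • lieDerivative C - C₀ - (g : K)⁻¹ • lieDerivative C = C - C₀ by
        abel] at this

theorem neg_one_le_basisGrade (b : ℕ ⊕ ℕ) : -1 ≤ basisGrade b := by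
  cases b <;> simp only [basisGrade] <;> omega

theorem exists_supportedInGrades {k : ℕ} {C : MultilinearMap K (fun _ : Fin k => Le K) K}
    (hC : C ∈ cochains K k) : ∃ G : Finset ℤ, SupportedInGrades C G := by
  obtain ⟨-, N, hN⟩ := hC
  -- Each grade is at least `-1`, and a basis element of grade above `N` lies in `filtration K N`,
  -- where `C` vanishes.
  refine ⟨Finset.Icc (-k) (k * N), fun b hb => ?_⟩
  by_contra h
  have hlt : ∀ i, basisGrade (b i) ≤ N := fun i => by
    by_contra hi
    exact h (hN _ i (basisElt_mem_filtration (by omega)))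
  refine hb (Finset.mem_Icc.2 ⟨?_, ?_⟩)
  · simpa using Finset.card_nsmul_le_sum Finset.univ (fun i => basisGrade (b i)) (-1)
      fun i _ => neg_one_le_basisGrade _
  · simpa using Finset.sum_le_card_nsmul Finset.univ (fun i => basisGrade (b i)) (N : ℤ)
      fun i _ => hlt i

/-- Every cocycle is cohomologous to a cocycle of grade zero. -/
theorem exists_supportedInGrades_zero [CharZero K] {k : ℕ}
    {C : MultilinearMap K (fun _ : Fin (k + 1) => Le K) K} (hC : C ∈ cocycles K (k + 1)) :
    ∃ C₀ ∈ cocycles K (k + 1), SupportedInGrades C₀ {0} ∧ C - C₀ ∈ coboundaries K (k + 1) := by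
  obtain ⟨G, hG⟩ := exists_supportedInGrades hC.1
  exact exists_supportedInGrades_zero_of_insert G hC fun b hb =>
    hG b fun h => hb (Finset.mem_insert_of_mem h)

end Contraction

end Leites

namespace Leites

/-! ### Cochains of grade zero -/

section GradeZero

variable {K : Type*} [Field K]

theorem apply_cons_eq_zero_iff {k : ℕ} {C : MultilinearMap K (fun _ : Fin (k + 1) => Le K) K}
    (hC : C ∈ cochains K (k + 1)) {p : ZMod 2} {x : Le K} (hx : x ∈ parityPart K p)
    {q : Fin k → ZMod 2} {w : Fin k → Le K} (hw : ∀ i, w i ∈ parityPart K (q i))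
    (j : Fin (k + 1)) : C (Fin.cons x w) = 0 ↔ C (j.insertNth x w) = 0 := by
  rw [apply_insertNth hC hx hw j, mul_eq_zero]
  simp

/-- Bring the second copy of `x` next to the first: swapping two equal even arguments gives `C =
-C`, and `2` is invertible. For odd arguments the cochain is symmetric, so repetition is allowed
there. -/
theorem apply_cons_eq_zero_of_eq [CharZero K] {k : ℕ}
    {C : MultilinearMap K (fun _ : Fin (k + 1) => Le K) K}
    (hC : C ∈ cochains K (k + 1)) {x : Le K} (hx : x ∈ parityPart K 0)
    {q : Fin k → ZMod 2} {w : Fin k → Le K} (hw : ∀ i, w i ∈ parityPart K (q i))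
    (j : Fin k) (hj : w j = x) : C (Fin.cons x w) = 0 := by
  obtain _ | k := k
  · exact j.elim0
  have h : C (Fin.cons x (Fin.cons x (j.removeNth w))) = 0 := by
    have hs := hC.1 0 1 rfl 0 0 (Fin.cons x (Fin.cons x (j.removeNth w))) hx hx
    have hcomp : (Fin.cons x (Fin.cons x (j.removeNth w)) : Fin (k + 2) → Le K) ∘
        Equiv.swap 0 1 = Fin.cons x (Fin.cons x (j.removeNth w)) := by
      rw [Equiv.comp_swap_eq_update]
      ext i
      rcases eq_or_ne i 0 with rfl | h0
      · simp
      · rcases eq_or_ne i 1 with rfl | h1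
        · simp
        · simp [h0, h1]
    rw [hcomp] at hs
    have : (2 : K) * C (Fin.cons x (Fin.cons x (j.removeNth w))) = 0 := by
      simp only [mul_zero, ZMod.val_zero, pow_zero] at hs
      linear_combination hs
    simpa using this
  rw [← MultilinearMap.curryLeft_apply] at h ⊢
  rw [apply_cons_eq_zero_iff (curryLeft_mem_cochains hC x) hx
    (q := fun m => q (j.succAbove m)) (w := j.removeNth w) (fun m => hw _) j] at h
  rwa [← hj, Fin.insertNth_self_removeNth, hj] at h

theorem apply_eq_zero_of_even_eq [CharZero K] {k : ℕ}
    {C : MultilinearMap K (fun _ : Fin k => Le K) K} (hC : C ∈ cochains K k)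
    {q : Fin k → ZMod 2} {u : Fin k → Le K} (hu : ∀ i, u i ∈ parityPart K (q i))
    {i j : Fin k} (hij : i ≠ j) (heq : u i = u j) (hi : u i ∈ parityPart K 0) : C u = 0 := by
  obtain _ | k := k
  · exact i.elim0
  obtain ⟨l, rfl⟩ := Fin.exists_succAbove_eq hij.symm
  have h := apply_cons_eq_zero_of_eq hC hi (q := fun m => q (i.succAbove m))
    (w := i.removeNth u) (fun m => hu _) l heq.symm
  rwa [apply_cons_eq_zero_iff hC hi (q := fun m => q (i.succAbove m))
    (w := i.removeNth u) (fun m => hu _) i, Fin.insertNth_self_removeNth] at h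

theorem eq_inl_zero_of_basisGrade_neg {b : ℕ ⊕ ℕ} (h : basisGrade b < 0) : b = .inl 0 := by
  cases b with
  | inl i =>
    simp only [basisGrade] at h
    obtain rfl : i = 0 := by omega
    rfl
  | inr i =>
    simp only [basisGrade] at h
    omega

theorem eq_inl_one_of_basisGrade_eq_zero {b : ℕ ⊕ ℕ} (h : basisGrade b = 0) : b = .inl 1 := by
  cases b with
  | inl i =>
    simp only [basisGrade] at h
    obtain rfl : i = 1 := by omega
    rfl
  | inr i =>
    simp only [basisGrade] at h
    omega

theorem eq_of_basisGrade_eq_one {b : ℕ ⊕ ℕ} (h : basisGrade b = 1) :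
    b = .inl 2 ∨ b = .inr 0 := by
  cases b with
  | inl i =>
    simp only [basisGrade] at h
    obtain rfl : i = 2 := by omega
    simp
  | inr i =>
    simp only [basisGrade] at h
    obtain rfl : i = 0 := by omega
    simp

theorem apply_basisElt_eq_zero_of_eq [CharZero K] {k : ℕ}
    {C : MultilinearMap K (fun _ : Fin k => Le K) K} (hC : C ∈ cochains K k)
    {b : Fin k → ℕ ⊕ ℕ} {i j : Fin k} (hij : i ≠ j) {n : ℕ} (hi : b i = .inl n)
    (hj : b j = .inl n) : C (fun m => basisElt K (b m)) = 0 := by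
  refine apply_eq_zero_of_even_eq hC (fun m => basisElt_mem_parityPart (b m)) hij ?_ ?_
  · simp only [hi, hj]
  · simp only [hi]
    exact basisElt_mem_parityPart (.inl n)

/-- A cochain of grade zero is determined by its values on tuples `(X, e₂, …)`, where
`e₂, …` are basis elements of non-negative grades which sum to one. -/
theorem eq_zero_of_apply_cons [CharZero K] {k : ℕ}
    {C : MultilinearMap K (fun _ : Fin (k + 2) => Le K) K} (hC : C ∈ cochains K (k + 2))
    (h0 : SupportedInGrades C {0})
    (h : ∀ b : Fin (k + 1) → ℕ ⊕ ℕ, (∀ i, 0 ≤ basisGrade (b i)) → ∑ i, basisGrade (b i) = 1 →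
      C (Fin.cons (basisElt K (.inl 0)) fun i => basisElt K (b i)) = 0) : C = 0 := by
  refine eq_zero_of_basisElt hC fun b => ?_
  by_cases hb : ∑ i, basisGrade (b i) = 0
  swap
  · exact h0 b (by simpa using hb)
  -- A negative entry is `X`. A second `X` kills the value; otherwise `X` is moved to the front at
  -- the cost of a sign, and the other grades sum to one.
  by_cases hneg : ∃ j, basisGrade (b j) < 0
  · obtain ⟨j, hj⟩ := hneg
    have hbj := eq_inl_zero_of_basisGrade_neg hj
    by_cases hneg' : ∃ l, basisGrade (b (j.succAbove l)) < 0
    · obtain ⟨l, hl⟩ := hneg'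
      exact apply_basisElt_eq_zero_of_eq hC (Fin.succAbove_ne j l).symm hbj
        (eq_inl_zero_of_basisGrade_neg hl)
    · push Not at hneg'
      rw [Fin.sum_univ_succAbove _ j, hbj] at hb
      have key := h (fun l => b (j.succAbove l)) hneg' (by simp only [basisGrade] at hb ⊢; omega)
      rw [apply_cons_eq_zero_iff hC (basisElt_mem_parityPart _)
        (fun m => basisElt_mem_parityPart (b (j.succAbove m))) j, ← hbj] at key
      rw [← key]
      congr 1
      exact (Fin.insertNth_self_removeNth j fun i => basisElt K (b i)).symm
  · push Not at hneg
    -- Without `X`, every grade is zero, so all of the at least two arguments equal `xX`.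
    have hz := (Finset.sum_eq_zero_iff_of_nonneg fun i _ => hneg i).1 hb
    exact apply_basisElt_eq_zero_of_eq hC (i := 0) (j := 1) (by simp)
      (eq_inl_one_of_basisGrade_eq_zero (hz 0 (Finset.mem_univ _)))
      (eq_inl_one_of_basisGrade_eq_zero (hz 1 (Finset.mem_univ _)))

/-- Beside `X` there are at least three non-negative grades with sum one, so two of the first three
are zero and `xX` occurs twice. -/
theorem eq_zero_of_four_le [CharZero K] {k : ℕ}
    {C : MultilinearMap K (fun _ : Fin (k + 4) => Le K) K} (hC : C ∈ cochains K (k + 4))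
    (h0 : SupportedInGrades C {0}) : C = 0 := by
  refine eq_zero_of_apply_cons hC h0 fun b hb hs => ?_
  have hpair : ∀ i j : Fin (k + 3), i ≠ j → basisGrade (b i) = 0 → basisGrade (b j) = 0 →
      C (Fin.cons (basisElt K (.inl 0)) fun i => basisElt K (b i)) = 0 := by
    intro i j hij hi hj
    rw [← MultilinearMap.curryLeft_apply]
    exact apply_basisElt_eq_zero_of_eq (curryLeft_mem_cochains hC _) hij
      (eq_inl_one_of_basisGrade_eq_zero hi) (eq_inl_one_of_basisGrade_eq_zero hj)
  rw [Fin.sum_univ_succ, Fin.sum_univ_succ, Fin.sum_univ_succ] at hs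
  have hrest := Finset.sum_nonneg fun (i : Fin k) (_ : i ∈ Finset.univ) => hb i.succ.succ.succ
  have g0 := hb 0
  have g1 := hb (Fin.succ 0)
  have g2 := hb (Fin.succ (Fin.succ 0))
  by_cases h : basisGrade (b 0) = 0
  · by_cases h' : basisGrade (b (Fin.succ 0)) = 0
    · exact hpair _ _ (Fin.succ_ne_zero _).symm h h'
    · exact hpair 0 (Fin.succ (Fin.succ 0)) (Fin.succ_ne_zero _).symm h (by omega)
  · exact hpair (Fin.succ 0) (Fin.succ (Fin.succ 0))
      (fun h => (Fin.succ_ne_zero _).symm (Fin.succ_injective _ h)) (by omega) (by omega)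

end GradeZero

/-! ### Exterior products and coordinates of brackets -/

section Wedge

variable {K : Type*} [Field K]

theorem wedge_apply {k : ℕ} (φ : Fin k → Le K →ₗ[K] K) (u : Fin k → Le K) :
    wedge K φ u = ∑ σ : Equiv.Perm (Fin k), Equiv.Perm.sign σ • ∏ i, φ i (u (σ i)) := by
  simp [wedge, MultilinearMap.alternatization_apply]

theorem wedge_eq_det {k : ℕ} (φ : Fin k → Le K →ₗ[K] K) (u : Fin k → Le K) :
    wedge K φ u = (Matrix.of fun i j => φ j (u i)).det := by
  rw [wedge_apply, Matrix.det_apply]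
  rfl

/-- The exterior product is alternating in the ordinary sense, which differs from the super sign
rule only when both arguments are odd. In that case every term vanishes, since only the factor `φ
i₀` can be nonzero on an odd argument. -/
theorem wedge_mem_cochains {k : ℕ} {φ : Fin k → Le K →ₗ[K] K} (i₀ : Fin k)
    (hodd : ∀ i ≠ i₀, ∀ x ∈ parityPart K 1, φ i x = 0) {N : ℕ}
    (hN : ∀ i, ∀ x ∈ filtration K N, φ i x = 0) : wedge K φ ∈ cochains K k := by
  refine ⟨fun i j hij p q u hi hj => ?_, N, fun u i hi => ?_⟩
  · have hne : i ≠ j := by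
      rintro rfl
      omega
    have hswap : wedge K φ (u ∘ Equiv.swap i j) = -wedge K φ u :=
      AlternatingMap.map_swap _ u hne
    rw [hswap]
    by_cases hpq : p = 1 ∧ q = 1
    · obtain ⟨rfl, rfl⟩ := hpq
      suffices wedge K φ u = 0 by simp [this]
      rw [wedge_apply]
      refine Finset.sum_eq_zero fun σ _ => ?_
      suffices ∃ a, φ a (u (σ a)) = 0 by
        obtain ⟨a, ha⟩ := this
        rw [Finset.prod_eq_zero (Finset.mem_univ a) ha, smul_zero]
      by_cases h : σ.symm i = i₀
      · refine ⟨σ.symm j, hodd _ (fun h' => hne (σ.symm.injective (h.trans h'.symm))) _ ?_⟩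
        simpa using hj
      · exact ⟨σ.symm i, hodd _ h _ (by simpa using hi)⟩
    · have : p * q = 0 := by
        revert hpq
        exact (by decide : ∀ p q : ZMod 2, ¬(p = 1 ∧ q = 1) → p * q = 0) p q
      simp [this]
  · rw [wedge_apply]
    refine Finset.sum_eq_zero fun σ _ => ?_
    rw [Finset.prod_eq_zero (Finset.mem_univ (σ.symm i)) (hN _ _ (by simpa using hi)), smul_zero]

theorem wedge_hasGrade {k : ℕ} {φ : Fin k → Le K →ₗ[K] K} {d : Fin k → ℤ}
    (hφ : ∀ i h, ∀ x ∈ gradePart K h, h ≠ d i → φ i x = 0) :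
    HasGrade K (wedge K φ) (∑ i, d i) := by
  intro h u hu hne
  rw [wedge_apply]
  refine Finset.sum_eq_zero fun σ _ => ?_
  suffices ∃ a, h (σ a) ≠ d a by
    obtain ⟨a, ha⟩ := this
    rw [Finset.prod_eq_zero (Finset.mem_univ a) (hφ _ _ _ (hu _) ha), smul_zero]
  by_contra! hall
  refine hne ?_
  rw [← Equiv.sum_comp σ]
  exact Finset.sum_congr rfl fun a _ => hall a

theorem basisElt_mem_gradePart (b : ℕ ⊕ ℕ) : basisElt K b ∈ gradePart K (basisGrade b) := by
  cases b with
  | inl i =>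
    refine ⟨_, rfl, fun n => ⟨by simp, fun h => ?_⟩⟩
    have : n = i := by
      by_contra hn
      simp [PowerSeries.coeff_X_pow, hn] at h
    simp [basisGrade, this]
  | inr i =>
    refine ⟨_, rfl, fun n => ⟨fun h => ?_, by simp⟩⟩
    have : n = i + 1 := by
      by_contra hn
      simp [PowerSeries.coeff_X_pow, hn] at h
    simp [basisGrade, this]

theorem HasGrade.supportedInGrades {k : ℕ} {C : MultilinearMap K (fun _ : Fin k => Le K) K}
    {g : ℤ} (h : HasGrade K C g) : SupportedInGrades C {g} := fun b hb =>
  h _ _ (fun i => basisElt_mem_gradePart (b i)) (by simpa using hb)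

theorem SupportedInGrades.sub {k : ℕ} {C D : MultilinearMap K (fun _ : Fin k => Le K) K}
    {G : Finset ℤ} (hC : SupportedInGrades C G) (hD : SupportedInGrades D G) :
    SupportedInGrades (C - D) G := fun b hb => by
  rw [sub_apply, hC b hb, hD b hb, sub_zero]

theorem SupportedInGrades.smul {k : ℕ} {C : MultilinearMap K (fun _ : Fin k => Le K) K}
    {G : Finset ℤ} (hC : SupportedInGrades C G) (c : K) :
    SupportedInGrades (c • C) G := fun b hb => by
  rw [smul_apply, hC b hb, smul_zero]

theorem dualE_eq_zero_of_odd (i : ℕ) {x : Le K} (hx : x ∈ parityPart K 1) : dualE K i x = 0 := by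
  obtain ⟨f, rfl⟩ := mem_parityPart_one.1 hx
  rw [dualE_toLe, TrivSqZeroExt.snd_inl, map_zero]

theorem dualO_eq_zero_of_even {i : ℕ} (hi : 1 ≤ i) {x : Le K} (hx : x ∈ parityPart K 0) :
    dualO K i hi x = 0 := by
  obtain ⟨f, rfl⟩ := mem_parityPart_zero.1 hx
  rw [dualO_toLe, TrivSqZeroExt.fst_inr, map_zero]

theorem dualE_eq_zero_of_mem_filtration {i N : ℕ} (h : i < N) {x : Le K}
    (hx : x ∈ filtration K N) : dualE K i x = 0 := by
  obtain ⟨f, rfl, hf⟩ := hx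
  exact (hf i h).2

theorem dualO_eq_zero_of_mem_filtration {i N : ℕ} (hi : 1 ≤ i) (h : i < N) {x : Le K}
    (hx : x ∈ filtration K N) : dualO K i hi x = 0 := by
  obtain ⟨f, rfl, hf⟩ := hx
  exact (hf i h).1

theorem dualE_eq_zero_of_mem_gradePart (i : ℕ) {h : ℤ} {x : Le K}
    (hx : x ∈ gradePart K h) (hne : h ≠ i - 1) : dualE K i x = 0 := by
  obtain ⟨f, rfl, hf⟩ := hx
  by_contra hz
  exact hne ((hf i).2 hz).symm

theorem dualO_eq_zero_of_mem_gradePart {i : ℕ} (hi : 1 ≤ i) {h : ℤ} {x : Le K}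
    (hx : x ∈ gradePart K h) (hne : h ≠ i) : dualO K i hi x = 0 := by
  obtain ⟨f, rfl, hf⟩ := hx
  by_contra hz
  exact hne ((hf i).1 hz).symm

theorem dualE_basisElt_inl (i j : ℕ) :
    dualE K i (basisElt K (.inl j)) = if i = j then 1 else 0 := by
  simp only [basisElt, dualE_toLe, TrivSqZeroExt.snd_inr, PowerSeries.coeff_X_pow]

theorem dualE_basisElt_inr (i j : ℕ) : dualE K i (basisElt K (.inr j)) = 0 :=
  dualE_eq_zero_of_odd i (basisElt_mem_parityPart (.inr j))

theorem dualO_basisElt_inl {i : ℕ} (hi : 1 ≤ i) (j : ℕ) :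
    dualO K i hi (basisElt K (.inl j)) = 0 :=
  dualO_eq_zero_of_even hi (basisElt_mem_parityPart (.inl j))

theorem dualO_basisElt_inr {i : ℕ} (hi : 1 ≤ i) (j : ℕ) :
    dualO K i hi (basisElt K (.inr j)) = if i = j + 1 then 1 else 0 := by
  simp only [basisElt, dualO_toLe, TrivSqZeroExt.fst_inl, PowerSeries.coeff_X_pow]

theorem coeff_zero_mul (f g : PowerSeries K) : PowerSeries.coeff 0 (f * g) =
    PowerSeries.coeff 0 f * PowerSeries.coeff 0 g := by
  simp

theorem coeff_two_mul (f g : PowerSeries K) : PowerSeries.coeff 2 (f * g) =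
    PowerSeries.coeff 0 f * PowerSeries.coeff 2 g + PowerSeries.coeff 1 f * PowerSeries.coeff 1 g +
      PowerSeries.coeff 2 f * PowerSeries.coeff 0 g := by
  rw [PowerSeries.coeff_mul, Finset.Nat.sum_antidiagonal_eq_sum_range_succ_mk]
  simp [Finset.sum_range_succ]

theorem coeff_one_mul' (f g : PowerSeries K) : PowerSeries.coeff 1 (f * g) =
    PowerSeries.coeff 0 f * PowerSeries.coeff 1 g +
      PowerSeries.coeff 1 f * PowerSeries.coeff 0 g := by
  rw [PowerSeries.coeff_mul, Finset.Nat.sum_antidiagonal_eq_sum_range_succ_mk]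
  simp [Finset.sum_range_succ]

/-- This and the next three formulas are the structure equations in the dual coordinates. They turn
the cocycle conditions for `a²`, `b³` and `a³` into polynomial identities. -/
theorem dualE_zero_leBracket (u v : Le K) :
    dualE K 0 (leBracket K u v) = dualE K 1 u * dualE K 0 v - dualE K 0 u * dualE K 1 v := by
  obtain ⟨f, rfl⟩ := (center K).mkQ_surjective u
  obtain ⟨g, rfl⟩ := (center K).mkQ_surjective v
  simp only [leBracket_toLe, dualE_toLe, buttinBracket_snd, map_sub, coeff_zero_mul,
    PowerSeries.coeff_derivative]
  push_cast
  ring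

theorem dualE_one_leBracket (u v : Le K) :
    dualE K 1 (leBracket K u v) =
      2 * (dualE K 2 u * dualE K 0 v - dualE K 0 u * dualE K 2 v) := by
  obtain ⟨f, rfl⟩ := (center K).mkQ_surjective u
  obtain ⟨g, rfl⟩ := (center K).mkQ_surjective v
  simp only [leBracket_toLe, dualE_toLe, buttinBracket_snd, map_sub, coeff_one_mul',
    PowerSeries.coeff_derivative]
  push_cast
  ring

theorem dualE_two_leBracket (u v : Le K) :
    dualE K 2 (leBracket K u v) =
      3 * (dualE K 3 u * dualE K 0 v - dualE K 0 u * dualE K 3 v) +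
        (dualE K 2 u * dualE K 1 v - dualE K 1 u * dualE K 2 v) := by
  obtain ⟨f, rfl⟩ := (center K).mkQ_surjective u
  obtain ⟨g, rfl⟩ := (center K).mkQ_surjective v
  simp only [leBracket_toLe, dualE_toLe, buttinBracket_snd, map_sub, coeff_two_mul,
    PowerSeries.coeff_derivative]
  push_cast
  ring

theorem dualO_one_leBracket (u v : Le K) :
    dualO K 1 le_rfl (leBracket K u v) =
      2 * (dualO K 2 one_le_two u * dualE K 0 v - dualE K 0 u * dualO K 2 one_le_two v) +
        (dualO K 1 le_rfl u * dualE K 1 v - dualE K 1 u * dualO K 1 le_rfl v) := by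
  obtain ⟨f, rfl⟩ := (center K).mkQ_surjective u
  obtain ⟨g, rfl⟩ := (center K).mkQ_surjective v
  simp only [leBracket_toLe, dualE_toLe, dualO_toLe, buttinBracket_fst, map_sub, coeff_one_mul',
    PowerSeries.coeff_derivative]
  push_cast
  ring

end Wedge

/-! ### The differential written out in degrees one to three -/

section LowDegree

variable {K : Type*} [Field K]

theorem differential_of_one (C : MultilinearMap K (fun _ : Fin 1 => Le K) K)
    (p : Fin 2 → ZMod 2) (u : Fin 2 → Le K) :
    differential K C p u = -C ![leBracket K (u 0) (u 1)] := by
  rw [differential, Fin.sum_univ_two, show Finset.Iio (0 : Fin 2) = ∅ from rfl,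
    show Finset.Iio (1 : Fin 2) = {0} from rfl, Finset.sum_empty, Finset.sum_singleton,
    show Finset.Ioo (0 : Fin 2) 1 = ∅ from rfl]
  have h : (1 : Fin 2).removeNth (Function.update u 0 (leBracket K (u 0) (u 1))) =
      ![leBracket K (u 0) (u 1)] := by
    ext i
    fin_cases i
    rfl
  simp [h]

theorem differential_of_two (C : MultilinearMap K (fun _ : Fin 2 => Le K) K)
    (p : Fin 3 → ZMod 2) (u : Fin 3 → Le K) :
    differential K C p u =
      -C ![leBracket K (u 0) (u 1), u 2] +
        ((-1) ^ (p 2 * p 1).val * C ![leBracket K (u 0) (u 2), u 1] +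
          C ![u 0, leBracket K (u 1) (u 2)]) := by
  have h01 : (1 : Fin 3).removeNth (Function.update u 0 (leBracket K (u 0) (u 1))) =
      ![leBracket K (u 0) (u 1), u 2] := by
    ext i
    fin_cases i <;> rfl
  have h02 : (2 : Fin 3).removeNth (Function.update u 0 (leBracket K (u 0) (u 2))) =
      ![leBracket K (u 0) (u 2), u 1] := by
    ext i
    fin_cases i <;> rfl
  have h12 : (2 : Fin 3).removeNth (Function.update u 1 (leBracket K (u 1) (u 2))) =
      ![u 0, leBracket K (u 1) (u 2)] := by
    ext i
    fin_cases i <;> rfl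
  rw [differential, Fin.sum_univ_three, show Finset.Iio (0 : Fin 3) = ∅ from rfl,
    show Finset.Iio (1 : Fin 3) = {0} from rfl, show Finset.Iio (2 : Fin 3) = {0, 1} from rfl,
    Finset.sum_empty, Finset.sum_singleton, Finset.sum_pair (by decide),
    show Finset.Ioo (0 : Fin 3) 1 = ∅ from rfl, show Finset.Ioo (0 : Fin 3) 2 = {1} from rfl,
    show Finset.Ioo (1 : Fin 3) 2 = ∅ from rfl, h01, h02, h12]
  simp [pow_add]

theorem differential_of_three (C : MultilinearMap K (fun _ : Fin 3 => Le K) K)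
    (p : Fin 4 → ZMod 2) (u : Fin 4 → Le K) :
    differential K C p u =
      -C ![leBracket K (u 0) (u 1), u 2, u 3] +
        ((-1) ^ (p 2 * p 1).val * C ![leBracket K (u 0) (u 2), u 1, u 3] +
          C ![u 0, leBracket K (u 1) (u 2), u 3]) -
        ((-1) ^ (p 3 * (p 1 + p 2)).val * C ![leBracket K (u 0) (u 3), u 1, u 2] +
          ((-1) ^ (p 3 * p 2).val * C ![u 0, leBracket K (u 1) (u 3), u 2] +
          C ![u 0, u 1, leBracket K (u 2) (u 3)])) := by
  have h01 : (1 : Fin 4).removeNth (Function.update u 0 (leBracket K (u 0) (u 1))) =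
      ![leBracket K (u 0) (u 1), u 2, u 3] := by
    ext i
    fin_cases i <;> rfl
  have h02 : (2 : Fin 4).removeNth (Function.update u 0 (leBracket K (u 0) (u 2))) =
      ![leBracket K (u 0) (u 2), u 1, u 3] := by
    ext i
    fin_cases i <;> rfl
  have h12 : (2 : Fin 4).removeNth (Function.update u 1 (leBracket K (u 1) (u 2))) =
      ![u 0, leBracket K (u 1) (u 2), u 3] := by
    ext i
    fin_cases i <;> rfl
  have h03 : (3 : Fin 4).removeNth (Function.update u 0 (leBracket K (u 0) (u 3))) =
      ![leBracket K (u 0) (u 3), u 1, u 2] := by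
    ext i
    fin_cases i <;> rfl
  have h13 : (3 : Fin 4).removeNth (Function.update u 1 (leBracket K (u 1) (u 3))) =
      ![u 0, leBracket K (u 1) (u 3), u 2] := by
    ext i
    fin_cases i <;> rfl
  have h23 : (3 : Fin 4).removeNth (Function.update u 2 (leBracket K (u 2) (u 3))) =
      ![u 0, u 1, leBracket K (u 2) (u 3)] := by
    ext i
    fin_cases i <;> rfl
  rw [differential, Fin.sum_univ_four, show Finset.Iio (0 : Fin 4) = ∅ from rfl,
    show Finset.Iio (1 : Fin 4) = {0} from rfl, show Finset.Iio (2 : Fin 4) = {0, 1} from rfl,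
    show Finset.Iio (3 : Fin 4) = {0, 1, 2} from rfl,
    Finset.sum_empty, Finset.sum_singleton, Finset.sum_pair (by decide),
    Finset.sum_insert (by decide), Finset.sum_pair (by decide),
    show Finset.Ioo (0 : Fin 4) 1 = ∅ from rfl, show Finset.Ioo (0 : Fin 4) 2 = {1} from rfl,
    show Finset.Ioo (1 : Fin 4) 2 = ∅ from rfl, show Finset.Ioo (0 : Fin 4) 3 = {1, 2} from rfl,
    show Finset.Ioo (1 : Fin 4) 3 = {2} from rfl, show Finset.Ioo (2 : Fin 4) 3 = ∅ from rfl,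
    Finset.sum_pair (by decide), h01, h02, h12, h03, h13, h23]
  simp [pow_add]
  ring

end LowDegree

end Leites

namespace Leites

/-! ### The cocycles `a²`, `b³`, `a³` -/

section Generators

variable {K : Type*} [Field K]

theorem a2_apply (u v : Le K) :
    a2 K ![u, v] = dualE K 0 u * dualO K 1 le_rfl v - dualO K 1 le_rfl u * dualE K 0 v := by
  rw [a2, wedge_eq_det, Matrix.det_fin_two]
  simp

theorem b3_apply (u v w : Le K) :
    b3 K ![u, v, w] = (Matrix.of ![![dualE K 0 u, dualE K 1 u, dualO K 1 le_rfl u],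
      ![dualE K 0 v, dualE K 1 v, dualO K 1 le_rfl v],
      ![dualE K 0 w, dualE K 1 w, dualO K 1 le_rfl w]]).det := by
  rw [b3, wedge_eq_det, Matrix.det_fin_three, Matrix.det_fin_three]
  simp

theorem a3_apply (u v w : Le K) :
    a3 K ![u, v, w] = (Matrix.of ![![dualE K 0 u, dualE K 1 u, dualE K 2 u],
      ![dualE K 0 v, dualE K 1 v, dualE K 2 v],
      ![dualE K 0 w, dualE K 1 w, dualE K 2 w]]).det := by
  rw [a3, wedge_eq_det, Matrix.det_fin_three, Matrix.det_fin_three]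
  simp

theorem a2_mem_cochains : a2 K ∈ cochains K 2 := by
  refine wedge_mem_cochains (N := 3) 1 ?_ ?_
  · intro i hi x hx
    fin_cases i
    · exact dualE_eq_zero_of_odd 0 hx
    · exact absurd rfl hi
  · intro i x hx
    fin_cases i
    · exact dualE_eq_zero_of_mem_filtration (by norm_num) hx
    · exact dualO_eq_zero_of_mem_filtration le_rfl (by norm_num) hx

theorem b3_mem_cochains : b3 K ∈ cochains K 3 := by
  refine wedge_mem_cochains (N := 3) 2 ?_ ?_
  · intro i hi x hx
    fin_cases i
    · exact dualE_eq_zero_of_odd 0 hx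
    · exact dualE_eq_zero_of_odd 1 hx
    · exact absurd rfl hi
  · intro i x hx
    fin_cases i
    · exact dualE_eq_zero_of_mem_filtration (by norm_num) hx
    · exact dualE_eq_zero_of_mem_filtration (by norm_num) hx
    · exact dualO_eq_zero_of_mem_filtration le_rfl (by norm_num) hx

theorem a3_mem_cochains : a3 K ∈ cochains K 3 := by
  -- All factors vanish on odd arguments, so the exempted slot `2` is an arbitrary choice. The bound
  -- `3` exceeds every coefficient index that occurs.
  refine wedge_mem_cochains (N := 3) 2 ?_ ?_
  · intro i hi x hx
    fin_cases i
    · exact dualE_eq_zero_of_odd 0 hx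
    · exact dualE_eq_zero_of_odd 1 hx
    · exact absurd rfl hi
  · intro i x hx
    fin_cases i
    · exact dualE_eq_zero_of_mem_filtration (by norm_num) hx
    · exact dualE_eq_zero_of_mem_filtration (by norm_num) hx
    · exact dualE_eq_zero_of_mem_filtration (by norm_num) hx

theorem a2_hasGrade : HasGrade K (a2 K) 0 := by
  have h := wedge_hasGrade (K := K) (φ := ![dualE K 0, dualO K 1 le_rfl]) (d := ![-1, 1]) (by
    intro i h x hx hne
    fin_cases i
    · exact dualE_eq_zero_of_mem_gradePart 0 hx (by simpa using hne)
    · exact dualO_eq_zero_of_mem_gradePart le_rfl hx (by simpa using hne))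
  simpa [a2, Fin.sum_univ_two] using h

theorem b3_hasGrade : HasGrade K (b3 K) 0 := by
  have h := wedge_hasGrade (K := K) (φ := ![dualE K 0, dualE K 1, dualO K 1 le_rfl])
    (d := ![-1, 0, 1]) (by
    intro i h x hx hne
    fin_cases i
    · exact dualE_eq_zero_of_mem_gradePart 0 hx (by simpa using hne)
    · exact dualE_eq_zero_of_mem_gradePart 1 hx (by simpa using hne)
    · exact dualO_eq_zero_of_mem_gradePart le_rfl hx (by simpa using hne))
  simpa [b3, Fin.sum_univ_three] using h

theorem a3_hasGrade : HasGrade K (a3 K) 0 := by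
  have h := wedge_hasGrade (K := K) (φ := ![dualE K 0, dualE K 1, dualE K 2])
    (d := ![-1, 0, 1]) (by
    intro i h x hx hne
    fin_cases i
    · exact dualE_eq_zero_of_mem_gradePart 0 hx (by simpa using hne)
    · exact dualE_eq_zero_of_mem_gradePart 1 hx (by simpa using hne)
    · refine dualE_eq_zero_of_mem_gradePart 2 hx ?_
      norm_num at hne ⊢
      exact hne)
  simpa [a3, Fin.sum_univ_three] using h

theorem dualE_eq_zero_or_dualO_eq_zero {p : ZMod 2} {x : Le K} (hx : x ∈ parityPart K p) :
    (p = 1 ∧ ∀ i, dualE K i x = 0) ∨ (p = 0 ∧ ∀ i hi, dualO K i hi x = 0) := by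
  obtain rfl | rfl : p = 0 ∨ p = 1 := (by decide : ∀ q : ZMod 2, q = 0 ∨ q = 1) p
  · exact Or.inr ⟨rfl, fun i hi => dualO_eq_zero_of_even hi hx⟩
  · exact Or.inl ⟨rfl, fun i => dualE_eq_zero_of_odd i hx⟩

theorem a2_mem_cocycles : a2 K ∈ cocycles K 2 := by
  refine ⟨a2_mem_cochains, fun p u hu => ?_⟩
  rw [differential_of_two]
  simp only [a2_apply, dualE_zero_leBracket, dualO_one_leBracket]
  -- A homogeneous argument has only `E` or only `O` coordinates. In each parity case the signs
  -- become explicit or multiply zero, and a polynomial identity remains.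
  rcases dualE_eq_zero_or_dualO_eq_zero (hu 0) with ⟨h0, h0'⟩ | ⟨h0, h0'⟩ <;>
  rcases dualE_eq_zero_or_dualO_eq_zero (hu 1) with ⟨h1, h1'⟩ | ⟨h1, h1'⟩ <;>
  rcases dualE_eq_zero_or_dualO_eq_zero (hu 2) with ⟨h2, h2'⟩ | ⟨h2, h2'⟩ <;>
  simp only [h0', h1', h2', h1, h2, mul_zero, zero_mul, ZMod.val_zero, pow_zero, sub_zero,
    add_zero] <;>
  ring

theorem b3_mem_cocycles : b3 K ∈ cocycles K 3 := by
  refine ⟨b3_mem_cochains, fun p u hu => ?_⟩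
  rw [differential_of_three]
  simp only [b3_apply, dualE_zero_leBracket, dualE_one_leBracket, dualO_one_leBracket,
    Matrix.det_fin_three, Matrix.of_apply, Matrix.cons_val]
  rcases dualE_eq_zero_or_dualO_eq_zero (hu 0) with ⟨h0, h0'⟩ | ⟨h0, h0'⟩ <;>
  rcases dualE_eq_zero_or_dualO_eq_zero (hu 1) with ⟨h1, h1'⟩ | ⟨h1, h1'⟩ <;>
  rcases dualE_eq_zero_or_dualO_eq_zero (hu 2) with ⟨h2, h2'⟩ | ⟨h2, h2'⟩ <;>
  rcases dualE_eq_zero_or_dualO_eq_zero (hu 3) with ⟨h3, h3'⟩ | ⟨h3, h3'⟩ <;>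
  simp only [h0', h1', h2', h3', h1, h2, h3, mul_zero, zero_mul, ZMod.val_zero, pow_zero,
    sub_zero, add_zero, zero_add] <;>
  ring

theorem a3_mem_cocycles : a3 K ∈ cocycles K 3 := by
  refine ⟨a3_mem_cochains, fun p u hu => ?_⟩
  rw [differential_of_three]
  simp only [a3_apply, dualE_zero_leBracket, dualE_one_leBracket, dualE_two_leBracket,
    Matrix.det_fin_three, Matrix.of_apply, Matrix.cons_val]
  rcases dualE_eq_zero_or_dualO_eq_zero (hu 0) with ⟨h0, h0'⟩ | ⟨h0, h0'⟩ <;>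
  rcases dualE_eq_zero_or_dualO_eq_zero (hu 1) with ⟨h1, h1'⟩ | ⟨h1, h1'⟩ <;>
  rcases dualE_eq_zero_or_dualO_eq_zero (hu 2) with ⟨h2, h2'⟩ | ⟨h2, h2'⟩ <;>
  rcases dualE_eq_zero_or_dualO_eq_zero (hu 3) with ⟨h3, h3'⟩ | ⟨h3, h3'⟩ <;>
  simp only [h0', h1', h2', h3', h1, h2, h3, mul_zero, zero_mul, ZMod.val_zero, pow_zero,
    sub_zero, add_zero, zero_add] <;>
  ring

theorem coeff_zero_buttinBracket (f g : Buttin K) :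
    PowerSeries.coeff 0 (buttinBracket K f g).fst = -a2 K ![toLe K f, toLe K g] := by
  rw [a2_apply, buttinBracket_fst, map_sub, coeff_zero_mul, coeff_zero_mul,
    PowerSeries.coeff_derivative, PowerSeries.coeff_derivative]
  simp only [dualE_toLe, dualO_toLe]
  push_cast
  ring

end Generators

/-! ### Brackets with `X` -/

section BasisBrackets

variable {K : Type*} [Field K]

theorem leBracket_inl_zero_inl (i : ℕ) :
    leBracket K (basisElt K (.inl 0)) (basisElt K (.inl (i + 1))) =
      (-(i + 1 : ℕ) : K) • basisElt K (.inl i) := by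
  rw [basisElt, basisElt, basisElt, leBracket_toLe, ← map_smul]
  congr 1
  ext1
  · simp [buttinBracket_fst]
  · ext n
    simp only [buttinBracket_snd, TrivSqZeroExt.snd_inr, TrivSqZeroExt.snd_smul, pow_zero, one_mul,
      Derivation.map_one_eq_zero, zero_mul, zero_sub, map_neg, PowerSeries.coeff_derivative,
      PowerSeries.coeff_X_pow, PowerSeries.coeff_smul, smul_eq_mul, add_left_inj]
    split_ifs with h
    · simp [h]
    · simp

/-- In `B(1)` the bracket is the constant `-1`, which is central. This is the source of the
nontrivial central extension. -/
theorem leBracket_inl_zero_inr_zero :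
    leBracket K (basisElt K (.inl 0)) (basisElt K (.inr 0)) = 0 := by
  rw [basisElt, basisElt, leBracket_toLe, Submodule.mkQ_apply, Submodule.Quotient.mk_eq_zero,
    center, Submodule.mem_span_singleton]
  refine ⟨-1, ?_⟩
  ext1
  · simp [buttinBracket_fst]
  · simp [buttinBracket_snd]

end BasisBrackets

end Leites

namespace Leites

/-! ### Computation of the cohomology groups -/

section Cohomology

variable {K : Type*} [Field K]

theorem apply_vecCons_smul_left (D : MultilinearMap K (fun _ : Fin 2 => Le K) K) (c : K)
    (x y : Le K) : D ![c • x, y] = c * D ![x, y] := by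
  have h := D.map_update_smul ![x, y] 0 c x
  have h0 : ∀ z, Function.update ![x, y] 0 z = ![z, y] := fun z => by
    ext i
    fin_cases i <;> rfl
  rwa [h0, h0, smul_eq_mul] at h

theorem apply_vecCons_smul_right (D : MultilinearMap K (fun _ : Fin 2 => Le K) K) (c : K)
    (x y : Le K) : D ![x, c • y] = c * D ![x, y] := by
  have h := D.map_update_smul ![x, y] 1 c y
  have h1 : ∀ z, Function.update ![x, y] 1 z = ![x, z] := fun z => by
    ext i
    fin_cases i <;> rfl
  simpa [h1] using h

theorem apply_basisElt_vec_two_self [CharZero K]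
    {D : MultilinearMap K (fun _ : Fin 2 => Le K) K} (hD : D ∈ cochains K 2) (n : ℕ) :
    D ![basisElt K (.inl n), basisElt K (.inl n)] = 0 := by
  refine apply_eq_zero_of_even_eq hD (q := fun _ => 0) (i := 0) (j := 1) ?_ (by decide) rfl
    (basisElt_mem_parityPart (.inl n))
  intro i
  fin_cases i <;> exact basisElt_mem_parityPart (.inl n)

/-- Coboundaries of degree two vanish at `(X, x)`. -/
theorem apply_eq_zero_of_mem_coboundaries_two
    {C : MultilinearMap K (fun _ : Fin 2 => Le K) K} (hC : C ∈ coboundaries K 2) :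
    C ![basisElt K (.inl 0), basisElt K (.inr 0)] = 0 := by
  obtain ⟨-, D, -, h⟩ := hC
  rw [h ![0, 1] _ (by
    intro i
    fin_cases i
    · exact basisElt_mem_parityPart (.inl 0)
    · exact basisElt_mem_parityPart (.inr 0)), differential_of_one]
  simp only [Matrix.cons_val]
  rw [leBracket_inl_zero_inr_zero, neg_eq_zero]
  exact D.map_coord_zero 0 rfl

/-- Coboundaries of degree three vanish at `(X, xX, x)`. -/
theorem apply_odd_eq_zero_of_mem_coboundaries_three
    {C : MultilinearMap K (fun _ : Fin 3 => Le K) K} (hC : C ∈ coboundaries K 3) :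
    C ![basisElt K (.inl 0), basisElt K (.inl 1), basisElt K (.inr 0)] = 0 := by
  obtain ⟨-, D, -, h⟩ := hC
  rw [h ![0, 0, 1] _ (by
    intro i
    fin_cases i
    · exact basisElt_mem_parityPart (.inl 0)
    · exact basisElt_mem_parityPart (.inl 1)
    · exact basisElt_mem_parityPart (.inr 0)), differential_of_two]
  simp only [Matrix.cons_val]
  -- Since `[X, xX] = -X`, `[X, x] = 0` and `[xX, x] = -x`, the two surviving terms are `D(X, x)`
  -- and `-D(X, x)`.
  rw [leBracket_inl_zero_inr_zero, leBracket_inl_zero_inl, euler_bracket_basisElt,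
    apply_vecCons_smul_left, apply_vecCons_smul_right,
    D.map_coord_zero (m := ![0, basisElt K (.inl 1)]) 0 rfl]
  simp [basisGrade]

/-- Coboundaries of degree three vanish at `(X, xX, x²X)`. -/
theorem apply_even_eq_zero_of_mem_coboundaries_three [CharZero K]
    {C : MultilinearMap K (fun _ : Fin 3 => Le K) K} (hC : C ∈ coboundaries K 3) :
    C ![basisElt K (.inl 0), basisElt K (.inl 1), basisElt K (.inl 2)] = 0 := by
  obtain ⟨-, D, hD, h⟩ := hC
  rw [h ![0, 0, 0] _ (by
    intro i
    fin_cases i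
    · exact basisElt_mem_parityPart (.inl 0)
    · exact basisElt_mem_parityPart (.inl 1)
    · exact basisElt_mem_parityPart (.inl 2)), differential_of_two]
  simp only [Matrix.cons_val]
  -- The outer terms are `D(X, x²X)` and `-D(X, x²X)`; the middle one is `-2 D(xX, xX)`, zero by
  -- skew symmetry.
  rw [leBracket_inl_zero_inl, leBracket_inl_zero_inl, euler_bracket_basisElt,
    apply_vecCons_smul_left, apply_vecCons_smul_left, apply_vecCons_smul_right,
    apply_basisElt_vec_two_self hD]
  simp [basisGrade]

/-- The cochain `C(xX)`. -/
noncomputable def wedgeOne (K : Type*) [Field K] : MultilinearMap K (fun _ : Fin 1 => Le K) K :=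
  wedge K ![dualE K 1]

/-- The cochain `C(X, x²X)`. -/
noncomputable def wedgeZeroTwo (K : Type*) [Field K] :
    MultilinearMap K (fun _ : Fin 2 => Le K) K :=
  wedge K ![dualE K 0, dualE K 2]

theorem wedgeZeroTwo_apply (u : Fin 2 → Le K) :
    wedgeZeroTwo K u =
      dualE K 0 (u 0) * dualE K 2 (u 1) - dualE K 2 (u 0) * dualE K 0 (u 1) := by
  rw [wedgeZeroTwo, wedge_eq_det, Matrix.det_fin_two]
  simp

theorem wedgeZeroTwo_hasGrade : HasGrade K (wedgeZeroTwo K) 0 := by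
  have h := wedge_hasGrade (K := K) (φ := ![dualE K 0, dualE K 2]) (d := ![-1, 1]) (by
    intro i h x hx hne
    fin_cases i
    · exact dualE_eq_zero_of_mem_gradePart 0 hx (by simpa using hne)
    · refine dualE_eq_zero_of_mem_gradePart 2 hx ?_
      norm_num at hne ⊢
      exact hne)
  simpa [wedgeZeroTwo, Fin.sum_univ_two] using h

theorem wedgeZeroTwo_mem_coboundaries [CharZero K] : wedgeZeroTwo K ∈ coboundaries K 2 := by
  -- The factor `2⁻¹` cancels the `2` in `dualE_one_leBracket`.
  refine ⟨wedge_mem_cochains (N := 3) 1 ?_ ?_, (2⁻¹ : K) • wedgeOne K,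
    Submodule.smul_mem _ _ (wedge_mem_cochains (N := 3) 0 ?_ ?_), fun p u _ => ?_⟩
  · intro i hi x hx
    fin_cases i
    · exact dualE_eq_zero_of_odd 0 hx
    · exact absurd rfl hi
  · intro i x hx
    fin_cases i
    · exact dualE_eq_zero_of_mem_filtration (by norm_num) hx
    · exact dualE_eq_zero_of_mem_filtration (by norm_num) hx
  · exact fun i hi => absurd (Subsingleton.elim _ _) hi
  · intro i x hx
    fin_cases i
    exact dualE_eq_zero_of_mem_filtration (by norm_num) hx
  · rw [differential_of_one, wedgeZeroTwo_apply, smul_apply, wedgeOne, wedge_eq_det, Matrix.det_fin_one]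
    simp only [Matrix.of_apply, Matrix.cons_val, dualE_one_leBracket, smul_eq_mul]
    field_simp
    ring

/-- In grade zero only the value at `xX` can be nonzero, and `xX` is a multiple of the commutator
`[X, x²X] = -2 xX`, on which a 1-cocycle vanishes. -/
theorem eq_zero_of_mem_cocycles_one [CharZero K]
    {C : MultilinearMap K (fun _ : Fin 1 => Le K) K} (hC : C ∈ cocycles K 1)
    (h0 : SupportedInGrades C {0}) : C = 0 := by
  refine eq_zero_of_basisElt hC.1 fun b => ?_
  by_cases hb : basisGrade (b 0) = 0
  swap
  · exact h0 b (by simpa using hb)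
  have h := hC.2 ![0, 0] ![basisElt K (.inl 0), basisElt K (.inl 2)] (by
    intro i
    fin_cases i
    · exact basisElt_mem_parityPart (.inl 0)
    · exact basisElt_mem_parityPart (.inl 2))
  rw [differential_of_one] at h
  simp only [Matrix.cons_val] at h
  rw [leBracket_inl_zero_inl] at h
  have hs := C.map_update_smul ![basisElt K (.inl 1)] 0 (-((1 + 1 : ℕ) : K)) (basisElt K (.inl 1))
  have hb' : (fun i => basisElt K (b i)) = ![basisElt K (.inl 1)] := by
    ext i
    fin_cases i
    simp [eq_inl_one_of_basisGrade_eq_zero hb]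
  have hv : ∀ x y : Le K, Function.update ![x] 0 y = ![y] := fun x y => by
    ext i
    fin_cases i
    rfl
  rw [hv, hv] at hs
  rw [hs] at h
  rw [hb']
  have : ((1 + 1 : ℕ) : K) ≠ 0 := by norm_num
  simpa [this] using h

/-- Both sides have grade zero, so it suffices to compare them at `(X, e)` with `e` of grade one,
that is, `e = x` or `e = x²X`. -/
theorem eq_of_supportedInGrades_two [CharZero K]
    {C : MultilinearMap K (fun _ : Fin 2 => Le K) K} (hC : C ∈ cochains K 2)
    (h0 : SupportedInGrades C {0}) :
    C = C ![basisElt K (.inl 0), basisElt K (.inr 0)] • a2 K +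
      C ![basisElt K (.inl 0), basisElt K (.inl 2)] • wedgeZeroTwo K := by
  set β := C ![basisElt K (.inl 0), basisElt K (.inr 0)] with hβ
  set γ := C ![basisElt K (.inl 0), basisElt K (.inl 2)] with hγ
  rw [← sub_eq_zero, ← sub_sub]
  have hone : ∀ c, basisGrade c = 1 →
      (C - β • a2 K - γ • wedgeZeroTwo K) ![basisElt K (.inl 0), basisElt K c] = 0 := by
    intro c hc
    simp only [sub_apply, smul_apply, a2_apply, wedgeZeroTwo_apply, smul_eq_mul, Matrix.cons_val]
    rcases eq_of_basisGrade_eq_one hc with rfl | rfl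
    · simp [dualE_basisElt_inl, dualO_basisElt_inl, hγ]
    · simp [dualE_basisElt_inl, dualE_basisElt_inr, dualO_basisElt_inr, hβ]
  refine eq_zero_of_apply_cons
    (sub_mem (sub_mem hC (Submodule.smul_mem _ _ a2_mem_cochains))
      (Submodule.smul_mem _ _ wedgeZeroTwo_mem_coboundaries.1))
    ((h0.sub (a2_hasGrade.supportedInGrades.smul _)).sub
      (wedgeZeroTwo_hasGrade.supportedInGrades.smul _)) fun b _ hb => ?_
  have hv : (Fin.cons (basisElt K (.inl 0)) fun i => basisElt K (b i) : Fin 2 → Le K) =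
      ![basisElt K (.inl 0), basisElt K (b 0)] := by
    ext i
    fin_cases i <;> rfl
  rw [hv]
  exact hone _ (by simpa using hb)

theorem apply_swap_eq_zero {C : MultilinearMap K (fun _ : Fin 3 => Le K) K}
    (hC : C ∈ cochains K 3) (x : Le K) (b c : ℕ ⊕ ℕ)
    (h : C ![x, basisElt K b, basisElt K c] = 0) : C ![x, basisElt K c, basisElt K b] = 0 := by
  have hs := hC.1 1 2 rfl _ _ ![x, basisElt K b, basisElt K c] (basisElt_mem_parityPart b)
    (basisElt_mem_parityPart c)
  rw [h, mul_zero] at hs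
  rw [← hs]
  congr 1
  ext i
  fin_cases i <;> rfl

/-- After `X`, the other two grades are `0` and `1` in some order. So the tuple is `(X, xX, e)`, up
to a swap, with `e = x` or `e = x²X`. -/
theorem eq_of_supportedInGrades_three [CharZero K]
    {C : MultilinearMap K (fun _ : Fin 3 => Le K) K} (hC : C ∈ cochains K 3)
    (h0 : SupportedInGrades C {0}) :
    C = C ![basisElt K (.inl 0), basisElt K (.inl 1), basisElt K (.inr 0)] • b3 K +
      C ![basisElt K (.inl 0), basisElt K (.inl 1), basisElt K (.inl 2)] • a3 K := by
  set β := C ![basisElt K (.inl 0), basisElt K (.inl 1), basisElt K (.inr 0)] with hβ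
  set α := C ![basisElt K (.inl 0), basisElt K (.inl 1), basisElt K (.inl 2)] with hα
  rw [← sub_eq_zero, ← sub_sub]
  have hD : C - β • b3 K - α • a3 K ∈ cochains K 3 :=
    sub_mem (sub_mem hC (Submodule.smul_mem _ _ b3_mem_cochains))
      (Submodule.smul_mem _ _ a3_mem_cochains)
  have hone : ∀ c, basisGrade c = 1 →
      (C - β • b3 K - α • a3 K) ![basisElt K (.inl 0), basisElt K (.inl 1), basisElt K c] = 0 := by
    intro c hc
    simp only [sub_apply, smul_apply, b3_apply, a3_apply, smul_eq_mul, Matrix.det_fin_three,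
      Matrix.of_apply, Matrix.cons_val]
    rcases eq_of_basisGrade_eq_one hc with rfl | rfl
    · simp [dualE_basisElt_inl, dualO_basisElt_inl, hα]
    · simp [dualE_basisElt_inl, dualE_basisElt_inr, dualO_basisElt_inl, dualO_basisElt_inr, hβ]
  refine eq_zero_of_apply_cons hD
    ((h0.sub (b3_hasGrade.supportedInGrades.smul _)).sub
      (a3_hasGrade.supportedInGrades.smul _)) fun b hpos hb => ?_
  have hv : (Fin.cons (basisElt K (.inl 0)) fun i => basisElt K (b i) : Fin 3 → Le K) =
      ![basisElt K (.inl 0), basisElt K (b 0), basisElt K (b 1)] := by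
    ext i
    fin_cases i <;> rfl
  rw [hv]
  rw [Fin.sum_univ_two] at hb
  have p0 := hpos 0
  have p1 := hpos 1
  by_cases h : basisGrade (b 0) = 0
  · rw [eq_inl_one_of_basisGrade_eq_zero h]
    exact hone _ (by omega)
  · rw [eq_inl_one_of_basisGrade_eq_zero (b := b 1) (by omega)]
    exact apply_swap_eq_zero hD _ _ _ (hone _ (by omega))

theorem cohomologyClass_eq_zero_iff {k : ℕ} {C : MultilinearMap K (fun _ : Fin k => Le K) K}
    (hC : C ∈ cocycles K k) : cohomologyClass K C hC = 0 ↔ C ∈ coboundaries K k := by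
  rw [cohomologyClass, Submodule.Quotient.mk_eq_zero]
  rfl

theorem subsingleton_cohomology {k : ℕ} (h : ∀ C ∈ cocycles K k, C ∈ coboundaries K k) :
    Subsingleton (Cohomology K k) := by
  rw [Submodule.Quotient.subsingleton_iff]
  exact eq_top_iff.2 fun C _ => h C C.2

theorem finrank_cohomology_zero : Module.finrank K (Cohomology K 0) = 1 := by
  have h : cocycles K 0 = ⊤ := by
    -- In degree zero the cochain conditions are vacuous, and the differential is an empty sum
    -- because a single argument admits no pair `i < j`.
    refine eq_top_iff.2 fun C _ => ⟨⟨fun i => i.elim0, 0, fun u i => i.elim0⟩, fun p u _ => ?_⟩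
    rw [differential, Fin.sum_univ_one, show Finset.Iio (0 : Fin 1) = ∅ from rfl,
      Finset.sum_empty]
  have hb : (coboundaries K 0).submoduleOf (cocycles K 0) = ⊥ := by
    rw [coboundaries, Submodule.submoduleOf, Submodule.comap_bot, Submodule.ker_subtype]
  rw [((Submodule.quotEquivOfEqBot _ hb).trans ((LinearEquiv.ofTop _ h).trans
    (MultilinearMap.constLinearEquivOfIsEmpty K K (fun _ : Fin 0 => Le K) K).symm)).finrank_eq,
    Module.finrank_self]

theorem subsingleton_cohomology_one [CharZero K] : Subsingleton (Cohomology K 1) := by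
  refine subsingleton_cohomology fun C hC => ?_
  obtain ⟨C₀, h₀, hs, hb⟩ := exists_supportedInGrades_zero hC
  rwa [eq_zero_of_mem_cocycles_one h₀ hs, sub_zero] at hb

theorem subsingleton_cohomology_of_four_le [CharZero K] {k : ℕ} (hk : 4 ≤ k) :
    Subsingleton (Cohomology K k) := by
  obtain ⟨k, rfl⟩ := Nat.exists_eq_add_of_le' hk
  refine subsingleton_cohomology fun C hC => ?_
  obtain ⟨C₀, h₀, hs, hb⟩ := exists_supportedInGrades_zero hC
  rwa [eq_zero_of_four_le h₀.1 hs, sub_zero] at hb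

theorem linearIndependent_a2 :
    LinearIndependent K ![cohomologyClass K (a2 K) a2_mem_cocycles] := by
  rw [linearIndependent_unique_iff]
  intro h
  have := apply_eq_zero_of_mem_coboundaries_two ((cohomologyClass_eq_zero_iff _).1 h)
  simp [a2_apply, dualE_basisElt_inl, dualE_basisElt_inr, dualO_basisElt_inr] at this

theorem span_a2 [CharZero K] :
    Submodule.span K {cohomologyClass K (a2 K) a2_mem_cocycles} = ⊤ := by
  refine eq_top_iff.2 fun c _ => ?_
  obtain ⟨⟨C, hC⟩, rfl⟩ := Submodule.mkQ_surjective _ c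
  obtain ⟨C₀, h₀, hs, hb⟩ := exists_supportedInGrades_zero hC
  have h := eq_of_supportedInGrades_two h₀.1 hs
  set β := C₀ ![basisElt K (.inl 0), basisElt K (.inr 0)]
  set γ := C₀ ![basisElt K (.inl 0), basisElt K (.inl 2)]
  refine Submodule.mem_span_singleton.2 ⟨β, ?_⟩
  rw [cohomologyClass, ← Submodule.Quotient.mk_smul, Submodule.mkQ_apply, eq_comm,
    Submodule.Quotient.eq]
  -- The component of `C₀` along `C(X, x²X)` is exact, so it joins the coboundary `C - C₀`.
  have key : C - β • a2 K = (C - C₀) + γ • wedgeZeroTwo K := by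
    rw [h]
    abel
  change C - β • a2 K ∈ coboundaries K 2
  rw [key]
  exact add_mem hb (Submodule.smul_mem _ _ wedgeZeroTwo_mem_coboundaries)

theorem linearIndependent_b3_a3 [CharZero K] :
    LinearIndependent K ![cohomologyClass K (b3 K) b3_mem_cocycles,
      cohomologyClass K (a3 K) a3_mem_cocycles] := by
  rw [LinearIndependent.pair_iff]
  intro s t h
  have hmem : s • b3 K + t • a3 K ∈ cocycles K 3 :=
    add_mem (Submodule.smul_mem _ _ b3_mem_cocycles) (Submodule.smul_mem _ _ a3_mem_cocycles)
  have hb := (cohomologyClass_eq_zero_iff hmem).1 h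
  have ho := apply_odd_eq_zero_of_mem_coboundaries_three hb
  have he := apply_even_eq_zero_of_mem_coboundaries_three hb
  simp only [add_apply, smul_apply, b3_apply, a3_apply, smul_eq_mul, Matrix.det_fin_three,
    Matrix.of_apply, Matrix.cons_val] at ho he
  refine ⟨?_, ?_⟩
  · simpa [dualE_basisElt_inl, dualE_basisElt_inr, dualO_basisElt_inl, dualO_basisElt_inr] using ho
  · simpa [dualE_basisElt_inl, dualO_basisElt_inl] using he

theorem span_b3_a3 [CharZero K] :
    Submodule.span K {cohomologyClass K (b3 K) b3_mem_cocycles,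
      cohomologyClass K (a3 K) a3_mem_cocycles} = ⊤ := by
  refine eq_top_iff.2 fun c _ => ?_
  obtain ⟨⟨C, hC⟩, rfl⟩ := Submodule.mkQ_surjective _ c
  obtain ⟨C₀, h₀, hs, hb⟩ := exists_supportedInGrades_zero hC
  have h := eq_of_supportedInGrades_three h₀.1 hs
  set β := C₀ ![basisElt K (.inl 0), basisElt K (.inl 1), basisElt K (.inr 0)]
  set α := C₀ ![basisElt K (.inl 0), basisElt K (.inl 1), basisElt K (.inl 2)]
  refine Submodule.mem_span_pair.2 ⟨β, α, ?_⟩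
  rw [cohomologyClass, cohomologyClass, ← Submodule.Quotient.mk_smul,
    ← Submodule.Quotient.mk_smul, ← Submodule.Quotient.mk_add, Submodule.mkQ_apply, eq_comm,
    Submodule.Quotient.eq]
  change C - (β • b3 K + α • a3 K) ∈ coboundaries K 3
  rwa [← h]

end Cohomology

end Leites

theorem mainTheorem1 (K : Type*) [Field K] [CharZero K] :
    ∃ (ha2 : Leites.a2 K ∈ Leites.cocycles K 2)
      (hb3 : Leites.b3 K ∈ Leites.cocycles K 3)
      (ha3 : Leites.a3 K ∈ Leites.cocycles K 3),
      -- in degree zero only the constants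
      Module.finrank K (Leites.Cohomology K 0) = 1 ∧
      Subsingleton (Leites.Cohomology K 1) ∧
      -- the class of `a²` is a basis of `H²`
      LinearIndependent K ![Leites.cohomologyClass K (Leites.a2 K) ha2] ∧
      Submodule.span K {Leites.cohomologyClass K (Leites.a2 K) ha2} = ⊤ ∧
      -- the classes of `b³` and `a³` are a basis of `H³`
      LinearIndependent K ![Leites.cohomologyClass K (Leites.b3 K) hb3,
        Leites.cohomologyClass K (Leites.a3 K) ha3] ∧
      Submodule.span K {Leites.cohomologyClass K (Leites.b3 K) hb3,
        Leites.cohomologyClass K (Leites.a3 K) ha3} = ⊤ ∧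
      (∀ k : ℕ, 4 ≤ k → k ≤ 20 → Subsingleton (Leites.Cohomology K k)) ∧
      -- the three cocycles have grade zero
      Leites.HasGrade K (Leites.a2 K) 0 ∧
      Leites.HasGrade K (Leites.b3 K) 0 ∧
      Leites.HasGrade K (Leites.a3 K) 0 ∧
      -- up to sign, `a²` is the cocycle of the central extension `B(1)` of `Le(1)`
      (∀ f g : Leites.Buttin K,
        PowerSeries.coeff 0 (Leites.buttinBracket K f g).fst =
          -Leites.a2 K ![Leites.toLe K f, Leites.toLe K g]) :=
  ⟨Leites.a2_mem_cocycles, Leites.b3_mem_cocycles, Leites.a3_mem_cocycles,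
    Leites.finrank_cohomology_zero, Leites.subsingleton_cohomology_one,
    Leites.linearIndependent_a2, Leites.span_a2, Leites.linearIndependent_b3_a3,
    Leites.span_b3_a3, fun _ hk _ => Leites.subsingleton_cohomology_of_four_le hk,
    Leites.a2_hasGrade, Leites.b3_hasGrade, Leites.a3_hasGrade,
    Leites.coeff_zero_buttinBracket⟩
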